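/- For all real numbers $\alpha>0$, $K$ and $D$ there are $\varepsilon>0$ and $n_0$, depending only on $\alpha,K,D$, such that the following holds. Let $V$ be a finite set of size $n\ge n_0$, and let $(X_t)_{t\ge 0}$ be a Markov chain on $V$ with transition probabilities $p(\cdot,\cdot)$ and an arbitrary distribution of $X_0$, that is reversible with respect to a stationary distribution $\pi$, i.e. $\pi_u\,p(u,v)=\pi_v\,p(v,u)$ for all $u,v\in V$. Suppose there is a set $W\subseteq V$ with $|W|\ge \alpha n$ such that $\pi_w>0$ for all $w\in W$ (this is automatic if the chain is irreducible) and $\pi_v\le K\pi_w$ for all $v,w\in W$. Then $$\Pr\big(\{X_t : 1\le t\le Dn\}=V\big)\le e^{-\varepsilon n}.$$ -/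

import Mathlib

open MeasureTheory

/-- `π` is a stationary distribution of the transition matrix `p` on the finite set `V`:
a probability vector with `π p = π`. -/
def IsStationaryDistribution {V : Type*} [Fintype V] (p : Matrix V V ℝ) (π : V → ℝ) : Prop :=
  π ∈ stdSimplex ℝ V ∧ Matrix.vecMul π p = π

/-- `p` is reversible with respect to `π`: the detailed balance equations
`π_u p(u,v) = π_v p(v,u)` hold. -/
def IsReversible {V : Type*} (p : Matrix V V ℝ) (π : V → ℝ) : Prop :=
  ∀ u v : V, π u * p u v = π v * p v u

/-- `X_0, X_1, …` is a (time-homogeneous) Markov chain on `V` under the law `P`, with transition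
matrix `p` and an arbitrary distribution of `X_0`: the `X_t` are random variables and, given
`X_0 = x_0, …, X_t = x_t`, the next state is `y` with probability `p(x_t, y)`. -/
structure IsMarkovChain {V Ω : Type*} [Fintype V] [DecidableEq V] [MeasurableSpace Ω]
    (P : Measure Ω) (p : Matrix V V ℝ) (X : ℕ → Ω → V) : Prop where
  stochastic : p ∈ Matrix.rowStochastic ℝ V
  measurable : ∀ (t : ℕ) (v : V), MeasurableSet {ω | X t ω = v}
  markov : ∀ (t : ℕ) (x : ℕ → V) (y : V),
    P.real {ω | (∀ i ≤ t, X i ω = x i) ∧ X (t + 1) ω = y} =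
      P.real {ω | ∀ i ≤ t, X i ω = x i} * p (x t) y

/-- The set `X_I = {X_t : t ∈ I}` of states seen at the times in `I`, for a trajectory `ω`. -/
def visited {V Ω : Type*} (X : ℕ → Ω → V) (I : Set ℕ) (ω : Ω) : Set V :=
  (fun t => X t ω) '' I

/-- The set of times `[a] = {1, 2, …, ⌊a⌋}` for a real number `a` (empty for `a < 1`). -/
def timesUpTo (a : ℝ) : Set ℕ := {t : ℕ | 1 ≤ t ∧ (t : ℝ) ≤ a}

/-! Suppose covering has probability A > exp(-εn), and weight the path law by its indicator. By the
Donsker-Varadhan inequality `pathExp_mul_le_of_exp_le`, an additive functional of the weighted chain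
can exceed what its exponential moments allow only by a multiple of -log A ≤ εn, which is small on
the scale of the time Dn. Two cases contradict this, according to the Green function ∑ p^k(v,v), k ≤
m, for a large constant m.

Recurrent case: on half of W the Green function is large, so escaping from such a vertex for m steps
is rare (`sum_pow_mul_noReturn_le_one`). A covering path has a last visit to each of these vertices,
hence linearly many rare escapes (`card_le_of_noReturn_le`).

Transient case: on half of W it is bounded. Pigeonholing over geometric windows (`exists_scale`)
gives a scale L = b^(i+1) and a set G of at least αn/4 vertices whose expected number of returns at
times in (2b^i, 2b^(i+1)] is O(1/(i+1)). Cut time into blocks of length L and split the chance that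
a block hits v into a near part (chance above δ) and a far part.

The near part is small because of reversibility. The occupation measure μ of the weighted chain has
small Donsker-Varadhan rate; testing the rate with a truncated √(μ/π) compares the flow of μ into v
with the flow that the chain sends out of v (`sum_flow_le`). Flow out of v to points from which v is
easily hit produces returns to v, which are rare at this scale (`sum_pow_near_le`,
`exists_offset_nearMass_le`).

For the far part, the indicator that v is not yet hit, divided by the product of the conditional
probabilities of this, is a martingale. The sum over v has increments O(L), so it stays near its
initial value up to probability exp(-cn/L) (`pathExp_avoidMartingale_tail`), whereas on a covering
path almost all terms end at 0 (`Covers.sum_avoidMartingale_le`). The terms are bounded only for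
vertices of bounded total chance, and that set must be fixed in advance: otherwise the few vertices
of large chance could carry the whole sum. The profile of chances is therefore approximated from a
multiset of about βn block starts, with a union bound over multisets. Taking β of order 1/((i+1)L)
keeps this entropy below n/L; the sampling error then forces δ, and with it the return bound, to be
of order 1/(i+1). This is affordable exactly because the harmonic series diverges. -/

/-- The path that starts at `x` and continues along `ω`. -/
def pathCons {V : Type*} (x : V) (ω : ℕ → V) : ℕ → V
  | 0 => x
  | t + 1 => ω t

/-- The path that follows `ω` up to time `a` and `ω'`, started at time `a`, afterwards. -/
def pathGlue {V : Type*} (a : ℕ) (ω ω' : ℕ → V) : ℕ → V :=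
  fun t => if t ≤ a then ω t else ω' (t - a)

/-- The path seen from time `a` on. -/
def pathShift {V : Type*} (a : ℕ) (ω : ℕ → V) : ℕ → V := fun t => ω (a + t)

/-- The expectation of `F` over the `k`-step paths of the chain `p` started at `x`; the paths are
extended by a constant after time `k`. -/
def pathExp {V : Type*} [Fintype V] (p : Matrix V V ℝ) : ℕ → V → ((ℕ → V) → ℝ) → ℝ
  | 0, x, F => F (fun _ => x)
  | k + 1, x, F => ∑ y, p x y * pathExp p k y (fun ω => F (pathCons x ω))

/-! ### Gluing and shifting of paths. -/

section Paths

variable {V : Type*}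

theorem pathGlue_of_le {a t : ℕ} (h : t ≤ a) (ω ω' : ℕ → V) : pathGlue a ω ω' t = ω t :=
  if_pos h

theorem pathGlue_add {a : ℕ} {ω ω' : ℕ → V} (h : ω' 0 = ω a) (t : ℕ) :
    pathGlue a ω ω' (a + t) = ω' t := by
  unfold pathGlue
  rcases Nat.eq_zero_or_pos t with rfl | ht
  · simp [h]
  · rw [if_neg (by omega)]; congr 1; omega

theorem pathShift_pathGlue {a : ℕ} {ω ω' : ℕ → V} (h : ω' 0 = ω a) :
    pathShift a (pathGlue a ω ω') = ω' :=
  funext fun t => pathGlue_add h t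

theorem pathGlue_succ_pathCons (a : ℕ) (x : V) (ω ω' : ℕ → V) :
    pathGlue (a + 1) (pathCons x ω) ω' = pathCons x (pathGlue a ω ω') := by
  funext t
  cases t with
  | zero => simp [pathGlue, pathCons]
  | succ t => simp [pathGlue, pathCons]

end Paths

/-! ### Linearity and the Markov property of path expectations. -/

section PathExp

variable {V : Type*} [Fintype V] {p : Matrix V V ℝ}

theorem pathExp_congr {F G : (ℕ → V) → ℝ} (k : ℕ) (x : V)
    (h : ∀ ω : ℕ → V, ω 0 = x → F ω = G ω) : pathExp p k x F = pathExp p k x G := by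
  cases k with
  | zero => exact h _ rfl
  | succ k =>
    simp only [pathExp]
    refine Finset.sum_congr rfl fun y _ => ?_
    congr 2
    funext ω
    exact h _ rfl

theorem pathExp_add (k : ℕ) (x : V) (F G : (ℕ → V) → ℝ) :
    pathExp p k x (fun ω => F ω + G ω) = pathExp p k x F + pathExp p k x G := by
  induction k generalizing x F G with
  | zero => rfl
  | succ k ih => simp only [pathExp, ih, mul_add, Finset.sum_add_distrib]

theorem pathExp_mul_left (k : ℕ) (x : V) (c : ℝ) (F : (ℕ → V) → ℝ) :
    pathExp p k x (fun ω => c * F ω) = c * pathExp p k x F := by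
  induction k generalizing x F with
  | zero => rfl
  | succ k ih =>
    simp only [pathExp, ih, Finset.mul_sum]
    exact Finset.sum_congr rfl fun y _ => by ring

theorem pathExp_mul_right (k : ℕ) (x : V) (c : ℝ) (F : (ℕ → V) → ℝ) :
    pathExp p k x (fun ω => F ω * c) = pathExp p k x F * c := by
  simp_rw [mul_comm _ c]; exact pathExp_mul_left k x c F

theorem pathExp_sub (k : ℕ) (x : V) (F G : (ℕ → V) → ℝ) :
    pathExp p k x (fun ω => F ω - G ω) = pathExp p k x F - pathExp p k x G := by
  have := pathExp_add (p := p) k x F (fun ω => (-1) * G ω)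
  rw [pathExp_mul_left] at this
  simp only [neg_mul, one_mul, ← sub_eq_add_neg] at this
  exact this

theorem pathExp_zero_fun (k : ℕ) (x : V) : pathExp p k x (fun _ => 0) = 0 := by
  simpa using pathExp_mul_left (p := p) k x 0 (fun _ => 0)

theorem pathExp_sum {ι : Type*} (s : Finset ι) (k : ℕ) (x : V) (F : ι → (ℕ → V) → ℝ) :
    pathExp p k x (fun ω => ∑ i ∈ s, F i ω) = ∑ i ∈ s, pathExp p k x (F i) := by
  classical
  induction s using Finset.induction_on with
  | empty => simpa using pathExp_zero_fun k x
  | insert i s hi ih => simp only [Finset.sum_insert hi, pathExp_add, ih]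

theorem pathExp_glue (a b : ℕ) (x : V) (F : (ℕ → V) → ℝ) :
    pathExp p (a + b) x F =
      pathExp p a x (fun ω => pathExp p b (ω a) (fun ω' => F (pathGlue a ω ω'))) := by
  induction a generalizing x F with
  | zero =>
    rw [Nat.zero_add]
    simp only [pathExp]
    refine pathExp_congr _ _ fun ω hω => ?_
    congr 1
    funext t
    cases t with
    | zero => simp [pathGlue, hω]
    | succ t => simp [pathGlue]
  | succ a ih =>
    rw [Nat.add_right_comm]
    simp only [pathExp, ih, pathGlue_succ_pathCons]
    rfl

/-- Markov property, for the product of a function of the first `a` steps and a function of the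
path from time `a` on. -/
theorem pathExp_mul_shift {F G : (ℕ → V) → ℝ} {a : ℕ} (hF : DependsOn F (Set.Iic a))
    (b : ℕ) (x : V) :
    pathExp p (a + b) x (fun ω => F ω * G (pathShift a ω)) =
      pathExp p a x (fun ω => F ω * pathExp p b (ω a) G) := by
  rw [pathExp_glue]
  refine pathExp_congr _ _ fun ω _ => ?_
  rw [← pathExp_mul_left]
  refine pathExp_congr _ _ fun ω' h => ?_
  rw [pathShift_pathGlue h, hF fun t ht => pathGlue_of_le ht ω ω']

end PathExp

/-! ### Path expectations of a stochastic matrix. -/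

section Stochastic

variable {V : Type*} [Fintype V] [DecidableEq V] {p : Matrix V V ℝ}

theorem pathExp_const (hp : p ∈ Matrix.rowStochastic ℝ V) (k : ℕ) (x : V) (c : ℝ) :
    pathExp p k x (fun _ => c) = c := by
  induction k generalizing x with
  | zero => rfl
  | succ k ih =>
    simp only [pathExp, ih, ← Finset.sum_mul, Matrix.sum_row_of_mem_rowStochastic hp, one_mul]

theorem pathExp_mono (hp : p ∈ Matrix.rowStochastic ℝ V) {F G : (ℕ → V) → ℝ} (k : ℕ) (x : V)
    (h : ∀ ω : ℕ → V, ω 0 = x → F ω ≤ G ω) : pathExp p k x F ≤ pathExp p k x G := by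
  induction k generalizing x F G with
  | zero => exact h _ rfl
  | succ k ih =>
    simp only [pathExp]
    exact Finset.sum_le_sum fun y _ => mul_le_mul_of_nonneg_left (ih y fun ω _ => h _ rfl)
      (Matrix.nonneg_of_mem_rowStochastic hp)

theorem pathExp_nonneg (hp : p ∈ Matrix.rowStochastic ℝ V) {F : (ℕ → V) → ℝ} (k : ℕ) (x : V)
    (h : ∀ ω : ℕ → V, ω 0 = x → 0 ≤ F ω) : 0 ≤ pathExp p k x F := by
  rw [← pathExp_const hp k x 0]
  exact pathExp_mono hp k x h

theorem pathExp_le_of_le (hp : p ∈ Matrix.rowStochastic ℝ V) {F : (ℕ → V) → ℝ} (k : ℕ) (x : V)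
    {c : ℝ} (h : ∀ ω : ℕ → V, ω 0 = x → F ω ≤ c) : pathExp p k x F ≤ c := by
  rw [← pathExp_const hp k x c]
  exact pathExp_mono hp k x h

theorem pathExp_add_of_dependsOn (hp : p ∈ Matrix.rowStochastic ℝ V) {F : (ℕ → V) → ℝ} {a : ℕ}
    (hF : DependsOn F (Set.Iic a)) (b : ℕ) (x : V) :
    pathExp p (a + b) x F = pathExp p a x F := by
  rw [pathExp_glue]
  refine pathExp_congr _ _ fun ω _ => ?_
  rw [pathExp_congr (G := fun _ => F ω) b (ω a), pathExp_const hp]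
  intro ω' _
  exact hF fun t ht => pathGlue_of_le ht _ _

theorem pathExp_of_dependsOn (hp : p ∈ Matrix.rowStochastic ℝ V) {F : (ℕ → V) → ℝ} {a T : ℕ}
    (hF : DependsOn F (Set.Iic a)) (h : a ≤ T) (x : V) :
    pathExp p T x F = pathExp p a x F := by
  obtain ⟨b, rfl⟩ := Nat.exists_eq_add_of_le h
  exact pathExp_add_of_dependsOn hp hF b x

theorem pathExp_apply (k : ℕ) (x : V) (f : V → ℝ) :
    pathExp p k x (fun ω => f (ω k)) = ∑ y, (p ^ k) x y * f y := by
  induction k generalizing x with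
  | zero => simp [pathExp, Matrix.one_apply]
  | succ k ih =>
    simp only [pathExp, pathCons, ih, pow_succ', Matrix.mul_apply, Finset.mul_sum, Finset.sum_mul]
    rw [Finset.sum_comm]
    exact Finset.sum_congr rfl fun y _ => Finset.sum_congr rfl fun z _ => by ring

theorem pathExp_apply_of_le (hp : p ∈ Matrix.rowStochastic ℝ V) {k T : ℕ} (h : k ≤ T) (x : V)
    (f : V → ℝ) : pathExp p T x (fun ω => f (ω k)) = ∑ y, (p ^ k) x y * f y := by
  rw [pathExp_of_dependsOn hp (a := k) _ h, pathExp_apply]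
  intro ω ω' hω
  simp only [hω k (Set.mem_Iic.2 le_rfl)]

/-- A product of block functionals, each of conditional mean at most `c`, has mean at most
`c ^ m`. -/
theorem pathExp_prod_le (hp : p ∈ Matrix.rowStochastic ℝ V) {g : ℕ → (ℕ → V) → ℝ} {c : ℝ}
    (i s m : ℕ) (hg0 : ∀ k < m, ∀ ω, 0 ≤ g k ω)
    (hdep : ∀ k < m, DependsOn (g k) (Set.Iic (i + k * s + s)))
    (hc : ∀ k < m, ∀ ω : ℕ → V,
      pathExp p s (ω (i + k * s)) (fun ω' => g k (pathGlue (i + k * s) ω ω')) ≤ c) (x : V) :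
    pathExp p (i + m * s) x (fun ω => ∏ k ∈ Finset.range m, g k ω) ≤ c ^ m := by
  induction m with
  | zero => simp [pathExp_const hp]
  | succ m ih =>
    have hprod : DependsOn (fun ω => ∏ k ∈ Finset.range m, g k ω) (Set.Iic (i + m * s)) := by
      intro ω ω' h
      refine Finset.prod_congr rfl fun k hk => ?_
      have hk' := Finset.mem_range.1 hk
      refine hdep k (by omega) fun t ht => h t ?_
      simp only [Set.mem_Iic] at ht ⊢
      have : (k + 1) * s ≤ m * s := Nat.mul_le_mul_right s hk'
      nlinarith
    have hnn : ∀ ω, 0 ≤ ∏ k ∈ Finset.range m, g k ω := fun ω =>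
      Finset.prod_nonneg fun k hk => hg0 k (by have := Finset.mem_range.1 hk; omega) ω
    have hc0 : 0 ≤ c := by
      refine le_trans ?_ (hc m (by omega) (fun _ => x))
      exact pathExp_nonneg hp _ _ fun ω _ => hg0 m (by omega) _
    have e : i + (m + 1) * s = i + m * s + s := by ring
    rw [e, pathExp_glue]
    calc _ ≤ pathExp p (i + m * s) x (fun ω => (∏ k ∈ Finset.range m, g k ω) * c) := by
          refine pathExp_mono hp _ _ fun ω _ => ?_
          rw [pathExp_congr (G := fun ω' => (∏ k ∈ Finset.range m, g k ω) *
            g m (pathGlue (i + m * s) ω ω')), pathExp_mul_left]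
          · exact mul_le_mul_of_nonneg_left (hc m (by omega) ω) (hnn ω)
          · intro ω' _
            rw [Finset.prod_range_succ]
            congr 1
            exact hprod fun t ht => pathGlue_of_le ht _ _
      _ ≤ c ^ m * c := by
          rw [pathExp_mul_right]
          exact mul_le_mul_of_nonneg_right (ih (fun k hk => hg0 k (by omega))
            (fun k hk => hdep k (by omega)) (fun k hk => hc k (by omega))) hc0
      _ = c ^ (m + 1) := (pow_succ c m).symm

end Stochastic

/-- Within one residue class modulo `s`, windows of length `s` do not overlap, so their exponential
moments multiply. -/
theorem sum_range_mul_eq_sum_sum {R : Type*} [AddCommMonoid R] (f : ℕ → R) (M s : ℕ) :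
    ∑ t ∈ Finset.range (M * s), f t =
      ∑ i ∈ Finset.range s, ∑ k ∈ Finset.range M, f (i + k * s) := by
  induction M with
  | zero => simp
  | succ M ih =>
    rw [Nat.succ_mul, Finset.sum_range_add, ih, ← Finset.sum_add_distrib]
    exact Finset.sum_congr rfl fun i _ => by rw [Finset.sum_range_succ, add_comm i (M * s)]

theorem dependsOn_comp_pathShift {V β : Type*} {g : (ℕ → V) → β} {s : ℕ}
    (hg : DependsOn g (Set.Iic s)) (a : ℕ) :
    DependsOn (fun ω => g (pathShift a ω)) (Set.Iic (a + s)) := by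
  intro ω ω' h
  refine hg fun t ht => h (a + t) ?_
  simp only [Set.mem_Iic] at ht ⊢
  omega

/-! ### Entropy inequality for the weighted path law. -/

section DonskerVaradhan

variable {V : Type*} [Fintype V] [DecidableEq V] {p : Matrix V V ℝ}

/-- The Donsker-Varadhan bound for the law with density proportional to `w`. -/
theorem pathExp_mul_le_of_exp_le (hp : p ∈ Matrix.rowStochastic ℝ V) {w Y : (ℕ → V) → ℝ} {b : ℝ}
    {T : ℕ} {x : V} (hw0 : ∀ ω, 0 ≤ w ω) (hw1 : ∀ ω, w ω ≤ 1) (hw : 0 < pathExp p T x w)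
    (hY : pathExp p T x (fun ω => Real.exp (Y ω)) ≤ Real.exp b) :
    pathExp p T x (fun ω => w ω * Y ω) ≤
      pathExp p T x w * (b - Real.log (pathExp p T x w)) := by
  set A := pathExp p T x w with hA
  -- The optimal shift in w(Y - a + 1) ≤ e^(Y - a): it makes the mean of the right side at most `A`.
  set a := b - Real.log A with ha
  have hexp : Real.exp (-a) * Real.exp b = A := by
    rw [← Real.exp_add, ha, show -(b - Real.log A) + b = Real.log A by ring, Real.exp_log hw]
  calc pathExp p T x (fun ω => w ω * Y ω)
      ≤ pathExp p T x (fun ω => Real.exp (-a) * Real.exp (Y ω) + (a - 1) * w ω) := by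
        refine pathExp_mono hp _ _ fun ω _ => ?_
        have h1 := Real.add_one_le_exp (Y ω - a)
        have h2 : Real.exp (Y ω - a) = Real.exp (-a) * Real.exp (Y ω) := by
          rw [← Real.exp_add]; ring_nf
        have h3 : w ω * Real.exp (Y ω - a) ≤ Real.exp (Y ω - a) :=
          mul_le_of_le_one_left (Real.exp_pos _).le (hw1 ω)
        have h4 := mul_le_mul_of_nonneg_left h1 (hw0 ω)
        rw [← h2]
        nlinarith
    _ = Real.exp (-a) * pathExp p T x (fun ω => Real.exp (Y ω)) + (a - 1) * A := by
        rw [pathExp_add, pathExp_mul_left, pathExp_mul_left]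
    _ ≤ Real.exp (-a) * Real.exp b + (a - 1) * A := by
        gcongr
    _ = A * a := by rw [hexp]; ring

/-- The windows are grouped by their start modulo `s`. Each class is a product of block functionals
with exponential moment at most e^(Mc), so the entropy inequality applies to it; the `s` classes are
then added. The spare block in `hT` makes room for every residue. -/
theorem pathExp_mul_sum_shift_le (hp : p ∈ Matrix.rowStochastic ℝ V) {w g : (ℕ → V) → ℝ} {c : ℝ}
    {s M T : ℕ} {x : V} (hT : (M + 1) * s ≤ T) (hw0 : ∀ ω, 0 ≤ w ω) (hw1 : ∀ ω, w ω ≤ 1)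
    (hw : 0 < pathExp p T x w) (hdep : DependsOn g (Set.Iic s))
    (hg : ∀ y, pathExp p s y (fun ω => Real.exp (g ω)) ≤ Real.exp c) :
    pathExp p T x (fun ω => w ω * ∑ t ∈ Finset.range (M * s), g (pathShift t ω)) ≤
      pathExp p T x w * (s * (M * c - Real.log (pathExp p T x w))) := by
  have key : ∀ i ∈ Finset.range s, pathExp p T x
      (fun ω => w ω * ∑ k ∈ Finset.range M, g (pathShift (i + k * s) ω)) ≤
      pathExp p T x w * (M * c - Real.log (pathExp p T x w)) := by
    intro i hi
    have hi' := Finset.mem_range.1 hi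
    refine pathExp_mul_le_of_exp_le hp hw0 hw1 hw ?_
    have hdep' : ∀ k, DependsOn (fun ω => Real.exp (g (pathShift (i + k * s) ω)))
        (Set.Iic (i + k * s + s)) := by
      intro k ω ω' h
      exact congrArg Real.exp (dependsOn_comp_pathShift hdep (i + k * s) h)
    have h1 := pathExp_prod_le hp (g := fun k ω => Real.exp (g (pathShift (i + k * s) ω)))
      (c := Real.exp c) i s M (fun _ _ _ => (Real.exp_pos _).le) (fun k _ => hdep' k) (by
        intro k _ ω
        rw [pathExp_congr (G := fun ω' => Real.exp (g ω'))]
        · exact hg _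
        · intro ω' h
          rw [pathShift_pathGlue h]) x
    have h2 : DependsOn (fun ω => ∏ k ∈ Finset.range M, Real.exp (g (pathShift (i + k * s) ω)))
        (Set.Iic (i + M * s)) := by
      intro ω ω' h
      refine Finset.prod_congr rfl fun k hk => hdep' k fun t ht => h t ?_
      simp only [Set.mem_Iic] at ht ⊢
      have : (k + 1) * s ≤ M * s := Nat.mul_le_mul_right s (Finset.mem_range.1 hk)
      nlinarith
    simp only [Real.exp_sum]
    rw [pathExp_of_dependsOn hp h2 (by nlinarith)]
    refine h1.trans (le_of_eq ?_)
    rw [← Real.exp_nat_mul]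
  simp only [sum_range_mul_eq_sum_sum, Finset.mul_sum (Finset.range s)]
  rw [pathExp_sum]
  refine (Finset.sum_le_sum key).trans (le_of_eq ?_)
  rw [Finset.sum_const, Finset.card_range, nsmul_eq_mul]
  ring

end DonskerVaradhan

/-! ### From the measure-theoretic chain to path expectations. -/

section Measure

variable {V Ω : Type*} [Fintype V] [DecidableEq V] [MeasurableSpace Ω] {P : Measure Ω}
  [IsProbabilityMeasure P] {p : Matrix V V ℝ} {X : ℕ → Ω → V}

-- Induction on the number of remaining steps, conditioning on the next state. Only an upper bound
-- is claimed, so subadditivity of the outer measure suffices and the event need not be shown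
-- measurable.
open Classical in
theorem IsMarkovChain.measureReal_prefix_inter_le (h : IsMarkovChain P p X) (A : Set (ℕ → V))
    (k t : ℕ) (hA : DependsOn (fun ω => ω ∈ A) (Set.Iic (t + k))) (z : ℕ → V) :
    P.real {ω | (∀ i ≤ t, X i ω = z i) ∧ (fun i => X i ω) ∈ A} ≤
      P.real {ω | ∀ i ≤ t, X i ω = z i} *
        pathExp p k (z t) (fun ω' => if pathGlue t z ω' ∈ A then 1 else 0) := by
  induction k generalizing t z with
  | zero =>
    simp only [pathExp]
    by_cases hz : z ∈ A
    · have : pathGlue t z (fun _ => z t) ∈ A := by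
        have := hA (x := pathGlue t z (fun _ => z t)) (y := z)
          (fun i hi => pathGlue_of_le (by simpa using hi) _ _)
        exact (iff_of_eq this).2 hz
      rw [if_pos this, mul_one]
      exact measureReal_mono fun ω hω => hω.1
    · have : {ω | (∀ i ≤ t, X i ω = z i) ∧ (fun i => X i ω) ∈ A} = ∅ := by
        ext ω
        simp only [Set.mem_ofPred_eq, Set.mem_empty_iff_false, iff_false, not_and]
        intro h1 h2
        have := hA (x := fun i => X i ω) (y := z) (fun i hi => h1 i (by simpa using hi))
        exact hz ((iff_of_eq this).1 h2)
      rw [this, measureReal_empty]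
      refine mul_nonneg measureReal_nonneg ?_
      split_ifs <;> norm_num
  | succ k ih =>
    simp only [pathExp, Finset.mul_sum]
    have hsub : {ω | (∀ i ≤ t, X i ω = z i) ∧ (fun i => X i ω) ∈ A} ⊆
        ⋃ y ∈ (Finset.univ : Finset V), {ω | (∀ i ≤ t + 1, X i ω = Function.update z (t + 1) y i) ∧
          (fun i => X i ω) ∈ A} := by
      intro ω hω
      simp only [Finset.mem_univ, Set.iUnion_true, Set.mem_iUnion, Set.mem_ofPred_eq]
      refine ⟨X (t + 1) ω, fun i hi => ?_, hω.2⟩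
      rcases Nat.lt_or_ge t i with h' | h'
      · obtain rfl : i = t + 1 := by omega
        simp
      · rw [Function.update_of_ne (by omega)]
        exact hω.1 i h'
    refine (measureReal_mono hsub (measure_ne_top P _)).trans ((measureReal_biUnion_finset_le _ _).trans ?_)
    refine Finset.sum_le_sum fun y _ => ?_
    refine (ih (t + 1) (by rwa [Nat.add_right_comm]) (Function.update z (t + 1) y)).trans ?_
    have e1 : {ω | ∀ i ≤ t + 1, X i ω = Function.update z (t + 1) y i} =
        {ω | (∀ i ≤ t, X i ω = z i) ∧ X (t + 1) ω = y} := by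
      ext ω
      simp only [Set.mem_ofPred_eq]
      constructor
      · intro h1
        refine ⟨fun i hi => ?_, by simpa using h1 (t + 1) le_rfl⟩
        have := h1 i (by omega)
        rwa [Function.update_of_ne (by omega)] at this
      · rintro ⟨h1, h2⟩ i hi
        rcases Nat.lt_or_ge t i with h' | h'
        · obtain rfl : i = t + 1 := by omega
          simpa using h2
        · rw [Function.update_of_ne (by omega)]
          exact h1 i h'
    rw [e1, h.markov t z y, mul_assoc]
    refine le_of_eq ?_
    congr 2
    simp only [Function.update_self]
    refine pathExp_congr _ _ fun ω' hω' => ?_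
    have : pathGlue (t + 1) (Function.update z (t + 1) y) ω' =
        pathGlue t z (pathCons (z t) ω') := by
      funext i
      unfold pathGlue
      rcases Nat.lt_or_ge t i with h' | h'
      · rcases Nat.lt_or_ge (t + 1) i with h'' | h''
        · rw [if_neg (by omega), if_neg (by omega)]
          obtain ⟨r, rfl⟩ := Nat.exists_eq_add_of_lt h''
          rw [show t + 1 + r + 1 - (t + 1) = r + 1 by omega,
            show t + 1 + r + 1 - t = r + 1 + 1 by omega]
          rfl
        · obtain rfl : i = t + 1 := by omega
          rw [if_pos le_rfl, if_neg (by omega)]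
          simp [pathCons, hω']
      · rw [if_pos (by omega), if_pos h', Function.update_of_ne (by omega)]
    rw [this]

open Classical in
/-- Uniform bounds over deterministic starting points carry over to the Markov chain. -/
theorem IsMarkovChain.measureReal_le (h : IsMarkovChain P p X) (A : Set (ℕ → V)) (T : ℕ)
    (hA : DependsOn (fun ω => ω ∈ A) (Set.Iic T)) {c : ℝ}
    (hc : ∀ x, pathExp p T x (fun ω => if ω ∈ A then 1 else 0) ≤ c) :
    P.real {ω | (fun i => X i ω) ∈ A} ≤ c := by
  have hsub : {ω | (fun i => X i ω) ∈ A} ⊆ ⋃ y ∈ (Finset.univ : Finset V),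
      {ω | (∀ i ≤ 0, X i ω = (fun _ => y) i) ∧ (fun i => X i ω) ∈ A} := by
    intro ω hω
    simp only [Finset.mem_univ, Set.iUnion_true, Set.mem_iUnion, Set.mem_ofPred_eq]
    refine ⟨X 0 ω, fun i hi => ?_, hω⟩
    obtain rfl : i = 0 := by omega
    rfl
  have hsum : ∑ y : V, P.real {ω | ∀ i ≤ 0, X i ω = (fun _ => y) i} = 1 := by
    rw [← measureReal_biUnion_finset]
    · have : (⋃ y ∈ (Finset.univ : Finset V), {ω | ∀ i ≤ 0, X i ω = (fun _ => y) i}) =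
          Set.univ := by
        ext ω
        simp
      rw [this]
      simp
    · intro y _ y' _ hyy'
      refine Set.disjoint_left.2 fun ω h1 h2 => hyy' ?_
      exact (h1 0 le_rfl).symm.trans (h2 0 le_rfl)
    · intro y _
      convert h.measurable 0 y using 1
      ext ω
      simp
  calc P.real {ω | (fun i => X i ω) ∈ A}
      ≤ ∑ y : V, P.real {ω | (∀ i ≤ 0, X i ω = (fun _ => y) i) ∧ (fun i => X i ω) ∈ A} :=
        (measureReal_mono hsub (measure_ne_top P _)).trans (measureReal_biUnion_finset_le _ _)
    _ ≤ ∑ y : V, P.real {ω | ∀ i ≤ 0, X i ω = (fun _ => y) i} * c := by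
        refine Finset.sum_le_sum fun y _ => ?_
        refine (h.measureReal_prefix_inter_le A T 0 (by rwa [Nat.zero_add]) _).trans ?_
        refine mul_le_mul_of_nonneg_left ?_ measureReal_nonneg
        refine le_trans (le_of_eq (pathExp_congr _ _ fun ω hω => ?_)) (hc y)
        have : pathGlue 0 (fun _ => y) ω = ω := by
          have := pathShift_pathGlue (a := 0) (ω := fun _ => y) (ω' := ω) hω
          funext i
          have := congrFun this i
          simpa [pathShift] using this
        rw [this]
    _ = c := by rw [← Finset.sum_mul, hsum, one_mul]

end Measure

/-! ### Recurrent vertices: last visits and escapes. -/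

/-- The path `ω` sees every vertex of `G` at the times `1, …, T`. -/
def Covers {V : Type*} (G : Finset V) (T : ℕ) (ω : ℕ → V) : Prop :=
  ∀ v ∈ G, ∃ t, 1 ≤ t ∧ t ≤ T ∧ ω t = v

/-- The path `ω` does not return to its starting point at the times `1, …, m`. -/
def NoReturn {V : Type*} (m : ℕ) (ω : ℕ → V) : Prop :=
  ∀ t, 1 ≤ t → t ≤ m → ω t ≠ ω 0

theorem dependsOn_noReturn {V : Type*} (m : ℕ) :
    DependsOn (NoReturn (V := V) m) (Set.Iic m) := by
  intro ω ω' h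
  have h0 := h 0 (Set.mem_Iic.2 (Nat.zero_le _))
  refine propext (forall_congr' fun t => forall_congr' fun _ => forall_congr' fun ht => ?_)
  rw [h0, h t (Set.mem_Iic.2 ht)]

-- Each vertex of `G` is sent to the time of its last visit up to `T`, an injective map. A last
-- visit before `N` is followed by `m` steps without return since N + m ≤ T; the others lie in [N,
-- T].
open Classical in
theorem Covers.card_le_sum_noReturn {V : Type*} [DecidableEq V] {G : Finset V} {N T m : ℕ}
    {ω : ℕ → V} (h : Covers G T ω) (hN : N + m ≤ T) :
    (G.card : ℝ) ≤ ∑ t ∈ Finset.range N,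
      (if ω t ∈ G ∧ NoReturn m (pathShift t ω) then (1 : ℝ) else 0) + ((T + 1 - N : ℕ) : ℝ) := by
  have hlast : ∀ v ∈ G, ∃ t, t ≤ T ∧ ω t = v ∧ ∀ r, t < r → r ≤ T → ω r ≠ v := by
    intro v hv
    obtain ⟨t, -, ht, hω⟩ := h v hv
    have hex : ∃ t ∈ (Finset.range (T + 1)).filter (fun t => ω t = v),
        ∀ r ∈ (Finset.range (T + 1)).filter (fun t => ω t = v), id r ≤ id t :=
      Finset.exists_max_image _ id
        ⟨t, Finset.mem_filter.2 ⟨Finset.mem_range.2 (by omega), hω⟩⟩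
    obtain ⟨t', ht', hmax⟩ := hex
    simp only [Finset.mem_filter, Finset.mem_range, id] at ht' hmax
    refine ⟨t', by omega, ht'.2, fun r h1 h2 h3 => ?_⟩
    have := hmax r ⟨by omega, h3⟩
    omega
  choose! τ hτ using hlast
  rw [Finset.sum_boole]
  norm_cast
  have hcard : ((Finset.Ico N (T + 1)).card) = T + 1 - N := Nat.card_Ico _ _
  rw [← hcard]
  refine le_trans ?_ (Finset.card_union_le _ _)
  refine Finset.card_le_card_of_injOn τ ?_ ?_
  · intro v hv
    have hv' : v ∈ G := hv
    obtain ⟨h1, h2, h3⟩ := hτ v hv'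
    simp only [Finset.coe_union, Set.mem_union, Finset.mem_coe, Finset.mem_filter,
      Finset.mem_range, Finset.mem_Ico]
    rcases Nat.lt_or_ge (τ v) N with h4 | h4
    · refine Or.inl ⟨h4, by rwa [h2], fun t ht1 ht2 => ?_⟩
      simp only [pathShift, Nat.add_zero, h2]
      exact h3 _ (by omega) (by omega)
    · exact Or.inr ⟨h4, by omega⟩
  · intro v hv v' hv' hvv
    rw [← (hτ v hv).2.1, ← (hτ v' hv').2.1, hvv]

section Recurrent

open Classical

variable {V : Type*} [Fintype V] [DecidableEq V] {p : Matrix V V ℝ}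

/-- The events "at `v` at time k, then no return for `m` steps", k ≤ m, are disjoint, and by the
Markov property the k-th one has probability p^k(v,v) times the escape probability. -/
theorem sum_pow_mul_noReturn_le_one (hp : p ∈ Matrix.rowStochastic ℝ V) (m : ℕ) (v : V) :
    (∑ k ∈ Finset.range (m + 1), (p ^ k) v v) *
      pathExp p m v (fun ω => if NoReturn m ω then 1 else 0) ≤ 1 := by
  set q := pathExp p m v (fun ω => if NoReturn m ω then 1 else 0) with hq
  have key : ∀ k ∈ Finset.range (m + 1), (p ^ k) v v * q = pathExp p (m + m) v
      (fun ω => (if ω k = v then 1 else 0) *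
        (fun ω => if NoReturn m ω then (1 : ℝ) else 0) (pathShift k ω)) := by
    intro k hk
    have hk' := Finset.mem_range.1 hk
    have hdep : DependsOn (fun ω : ℕ → V => if ω k = v then (1 : ℝ) else 0) (Set.Iic k) := by
      intro ω ω' h
      simp only [h k (Set.mem_Iic.2 le_rfl)]
    have hdep2 : DependsOn (fun ω : ℕ → V => if NoReturn m ω then (1 : ℝ) else 0) (Set.Iic m) := by
      intro ω ω' h
      simp only [dependsOn_noReturn m h]
    have hdep3 : DependsOn (fun ω => (if ω k = v then 1 else 0) *
        (fun ω => if NoReturn m ω then (1 : ℝ) else 0) (pathShift k ω)) (Set.Iic (k + m)) := by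
      intro ω ω' h
      have h1 := hdep fun t ht => h t (Set.Iic_subset_Iic.2 (Nat.le_add_right k m) ht)
      have h2 := dependsOn_comp_pathShift hdep2 k h
      simp only at h1 h2
      simp only [h1, h2]
    rw [pathExp_of_dependsOn hp hdep3 (by omega),
      pathExp_mul_shift (G := fun ω => if NoReturn m ω then (1 : ℝ) else 0) hdep]
    have := pathExp_apply (p := p) k v (fun y => if y = v then q else 0)
    simp only [mul_ite, mul_zero, Finset.sum_ite_eq', Finset.mem_univ, if_true] at this
    rw [← this]
    refine pathExp_congr _ _ fun ω _ => ?_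
    split_ifs with h
    · rw [h, one_mul]
    · rw [zero_mul]
  rw [Finset.sum_mul, Finset.sum_congr rfl key, ← pathExp_sum]
  refine pathExp_le_of_le hp _ _ fun ω _ => ?_
  simp only [mul_ite, mul_one, mul_zero, ← ite_and]
  rw [Finset.sum_boole]
  norm_cast
  refine Finset.card_le_one.2 ?_
  have aux : ∀ a b, a < b → b < m + 1 → ω b = v → ω a = v → ¬ NoReturn m (pathShift a ω) := by
    intro a b hab hb h1 h2 h3
    refine h3 (b - a) (by omega) (by omega) ?_
    simp only [pathShift, Nat.add_zero]
    rw [show a + (b - a) = b by omega, h1, h2]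
  intro a ha b hb
  simp only [Finset.mem_filter, Finset.mem_range] at ha hb
  rcases lt_trichotomy a b with h | h | h
  · exact absurd ha.2.1 (aux a b h hb.1 hb.2.2 ha.2.2)
  · exact h
  · exact absurd hb.2.1 (aux b a h ha.1 ha.2.2 hb.2.2)

/-- A set of vertices to each of which the chain returns soon with high probability is unlikely to
be covered in linear time. -/
theorem card_le_of_noReturn_le (hp : p ∈ Matrix.rowStochastic ℝ V) {G : Finset V} {ρ : ℝ}
    {w : (ℕ → V) → ℝ} {m M T : ℕ} {x : V} (hT : (M + 1) * m ≤ T) (hT' : T + 1 ≤ (M + 2) * m)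
    (hρ : ∀ v ∈ G, pathExp p m v (fun ω => if NoReturn m ω then 1 else 0) ≤ ρ) (hρ0 : 0 ≤ ρ)
    (hw0 : ∀ ω, 0 ≤ w ω) (hw1 : ∀ ω, w ω ≤ 1) (hw : 0 < pathExp p T x w)
    (hcov : ∀ ω, w ω ≠ 0 → Covers G T ω) :
    ((G.card : ℝ) - 2 * m) * Real.log 2 ≤ m * (M * ρ - Real.log (pathExp p T x w)) := by
  -- The value log 2 makes e^g equal to 1 plus an indicator, of mean at most 1 + ρ ≤ e^ρ.
  set g : (ℕ → V) → ℝ := fun ω => if ω 0 ∈ G ∧ NoReturn m ω then Real.log 2 else 0 with hg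
  have hdep : DependsOn g (Set.Iic m) := by
    intro ω ω' h
    simp only [hg, dependsOn_noReturn m h, h 0 (Set.mem_Iic.2 (Nat.zero_le _))]
  have hexp : ∀ y, pathExp p m y (fun ω => Real.exp (g ω)) ≤ Real.exp ρ := by
    intro y
    by_cases hy : y ∈ G
    · calc pathExp p m y (fun ω => Real.exp (g ω))
          = pathExp p m y (fun ω => 1 + if NoReturn m ω then 1 else 0) := by
            refine pathExp_congr _ _ fun ω h => ?_
            simp only [hg, h, hy, true_and]
            split_ifs
            · rw [Real.exp_log (by norm_num)]; norm_num
            · simp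
        _ ≤ 1 + ρ := by
            rw [pathExp_add, pathExp_const hp]
            linarith [hρ y hy]
        _ ≤ Real.exp ρ := by linarith [Real.add_one_le_exp ρ]
    · calc pathExp p m y (fun ω => Real.exp (g ω)) = pathExp p m y (fun _ => 1) := by
            refine pathExp_congr _ _ fun ω h => ?_
            simp [hg, h, hy]
        _ ≤ Real.exp ρ := by
            rw [pathExp_const hp]
            exact Real.one_le_exp hρ0
  have h1 := pathExp_mul_sum_shift_le hp hT hw0 hw1 hw hdep hexp
  have h2 : pathExp p T x w * (((G.card : ℝ) - 2 * m) * Real.log 2) ≤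
      pathExp p T x (fun ω => w ω * ∑ t ∈ Finset.range (M * m), g (pathShift t ω)) := by
    rw [← pathExp_mul_right]
    refine pathExp_mono hp _ _ fun ω _ => ?_
    by_cases hω : w ω = 0
    · simp [hω]
    refine mul_le_mul_of_nonneg_left ?_ (hw0 ω)
    have h3 := (hcov ω hω).card_le_sum_noReturn (N := M * m) (m := m) (by linarith)
    have h4 : ((T + 1 - M * m : ℕ) : ℝ) ≤ 2 * m := by
      have : T + 1 - M * m ≤ 2 * m := by
        have : (M + 2) * m = M * m + 2 * m := by ring
        omega
      exact_mod_cast this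
    have h5 : ∑ t ∈ Finset.range (M * m), g (pathShift t ω) =
        (∑ t ∈ Finset.range (M * m),
          (if ω t ∈ G ∧ NoReturn m (pathShift t ω) then (1 : ℝ) else 0)) * Real.log 2 := by
      rw [Finset.sum_mul]
      refine Finset.sum_congr rfl fun t _ => ?_
      simp only [hg, pathShift, Nat.add_zero, ite_mul, one_mul, zero_mul]
      rfl
    rw [h5]
    exact mul_le_mul_of_nonneg_right (by linarith) (Real.log_nonneg (by norm_num))
  exact le_of_mul_le_mul_left (h2.trans h1) hw

end Recurrent

/-! ### Reversibility: the rate of an occupation measure controls its flow. -/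

section Ratio

/-- Both √(min f M + κ) and f / √(min f M + κ) are nondecreasing in f, so the two factors have the
same sign. -/
theorem mul_sub_div_sqrt_nonneg {f g κ M : ℝ} (hf : 0 ≤ f) (hg : 0 ≤ g) (hκ : 0 < κ)
    (hM : 0 ≤ M) :
    0 ≤ (√(min f M + κ) - √(min g M + κ)) *
      (f / √(min f M + κ) - g / √(min g M + κ)) := by
  wlog h : g ≤ f generalizing f g
  · have := this hg hf (le_of_not_ge h)
    linarith
  have hmin : min g M ≤ min f M := min_le_min_right M h
  have hf0 : 0 ≤ min f M := le_min hf hM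
  have hg0 : 0 ≤ min g M := le_min hg hM
  have hbpos : 0 < √(min g M + κ) := Real.sqrt_pos.2 (by linarith)
  have hapos : 0 < √(min f M + κ) := Real.sqrt_pos.2 (by linarith)
  refine mul_nonneg (sub_nonneg.2 (Real.sqrt_le_sqrt (by linarith))) (sub_nonneg.2 ?_)
  rw [div_le_div_iff₀ hbpos hapos]
  have key : g * min f M ≤ f * min g M := by
    rcases le_total g M with h1 | h1
    · rw [min_eq_left h1]
      nlinarith [min_le_left f M]
    · rw [min_eq_right h1]
      nlinarith [min_le_right f M]
  rw [← abs_of_nonneg (mul_nonneg hg hapos.le), ← abs_of_nonneg (mul_nonneg hf hbpos.le)]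
  refine sq_le_sq.1 ?_
  rw [mul_pow, mul_pow, Real.sq_sqrt (by linarith), Real.sq_sqrt (by linarith)]
  nlinarith [mul_le_mul_of_nonneg_left key hg, mul_le_mul_of_nonneg_right h (mul_nonneg hf hg0),
    mul_self_le_mul_self hg h]

/-- Let a and b be the two roots. The gap of a factor 4 gives b ≤ a/2 and g/b ≤ b ≤ a/2, so the
product is at least (a/2)(f/a - a/2) = f/2 - a²/4, and a² ≤ f + κ ≤ 5f/4. -/
theorem le_mul_sub_div_sqrt {f g κ M : ℝ} (hg : 0 ≤ g) (hκ : 0 < κ)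
    (hfg : 4 * (g + κ) ≤ f) (hMg : 4 * (g + κ) ≤ M + κ) :
    3 / 16 * f ≤ (√(min f M + κ) - √(min g M + κ)) *
      (f / √(min f M + κ) - g / √(min g M + κ)) := by
  have hgM : min g M = g := min_eq_left (by linarith)
  rw [hgM]
  have hmin : 4 * (g + κ) ≤ min f M + κ := by
    rcases le_total f M with h | h
    · rw [min_eq_left h]; linarith
    · rw [min_eq_right h]; linarith
  set a := √(min f M + κ) with ha
  set b := √(g + κ) with hb
  have ha2 : a ^ 2 = min f M + κ := Real.sq_sqrt (by linarith)
  have hb2 : b ^ 2 = g + κ := Real.sq_sqrt (by linarith)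
  have hapos : 0 < a := Real.sqrt_pos.2 (by linarith)
  have hbpos : 0 < b := Real.sqrt_pos.2 (by linarith)
  have hab : 2 * b ≤ a := by
    refine le_of_sq_le_sq ?_ hapos.le
    nlinarith
  have h1 : g / b ≤ a / 2 := by
    rw [div_le_iff₀ hbpos]
    nlinarith
  have h2 : a ^ 2 ≤ 5 / 4 * f := by
    rw [ha2]
    have := min_le_left f M
    linarith
  have h3 : a / 2 ≤ f / a := by
    rw [le_div_iff₀ hapos]
    nlinarith
  calc 3 / 16 * f ≤ a / 2 * (f / a - a / 2) := by
        have : a / 2 * (f / a - a / 2) = f / 2 - a ^ 2 / 4 := by field_simp; ring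
        rw [this]; linarith
    _ ≤ (a - b) * (f / a - g / b) := by
        apply mul_le_mul <;> linarith

variable {V : Type*}

/-- The test function attached to the occupation measure `μ`: the square root of the density
`μ / π`, cut off below at `κ` and above at `M`. -/
noncomputable def densityRoot (π μ : V → ℝ) (κ M : ℝ) (x : V) : ℝ :=
  if π x = 0 then √(M + κ) else √(min (μ x / π x) M + κ)

variable {π μ : V → ℝ} {κ M : ℝ}

theorem sqrt_le_densityRoot (hπ : ∀ x, 0 ≤ π x) (hμ : ∀ x, 0 ≤ μ x)
    (hM : 0 ≤ M) (x : V) : √κ ≤ densityRoot π μ κ M x := by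
  unfold densityRoot
  split_ifs with h
  · exact Real.sqrt_le_sqrt (by linarith)
  · exact Real.sqrt_le_sqrt (by linarith [le_min (div_nonneg (hμ x) (hπ x)) hM])

theorem densityRoot_le_sqrt (x : V) :
    densityRoot π μ κ M x ≤ √(M + κ) := by
  unfold densityRoot
  split_ifs with h
  · exact le_rfl
  · exact Real.sqrt_le_sqrt (by linarith [min_le_right (μ x / π x) M])

variable {P : Matrix V V ℝ}

/-- Detailed balance gives both directions of the pair the common weight π x P x y; the rest is a
product of differences to which the scalar inequalities above apply. -/
theorem densityRoot_pair_eq (hrev : IsReversible P π) {x y : V}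
    (hx : 0 < π x) (hy : 0 < π y) (u : V → ℝ) (hux : 0 < u x) (huy : 0 < u y) :
    μ x * P x y * (1 - u y / u x) + μ y * P y x * (1 - u x / u y) =
      (π x * P x y) * ((u x - u y) * (μ x / π x / u x - μ y / π y / u y)) := by
  have h1 : P y x = π x * P x y / π y := by rw [hrev x y]; field_simp
  rw [h1]
  field_simp
  ring

variable [Fintype V] [DecidableEq V]

/-- The bound -log t ≥ 1 - t, with t the ratio of Pu to u, linearises the Donsker-Varadhan rate. -/
theorem sum_mul_log_sub_ge (hP : P ∈ Matrix.rowStochastic ℝ V)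
    (hμ : ∀ x, 0 ≤ μ x) {u : V → ℝ} (hu : ∀ x, 0 < u x) :
    ∑ x, ∑ y, μ x * P x y * (1 - u y / u x) ≤
      ∑ x, μ x * (Real.log (u x) - Real.log (∑ y, P x y * u y)) := by
  refine Finset.sum_le_sum fun x _ => ?_
  have hnn : 0 ≤ ∑ y, P x y * u y := Finset.sum_nonneg fun y _ =>
    mul_nonneg (Matrix.nonneg_of_mem_rowStochastic hP) (hu y).le
  have hrow := Matrix.sum_row_of_mem_rowStochastic hP x
  have hpos : 0 < ∑ y, P x y * u y := by
    obtain ⟨y, -, hy⟩ : ∃ y ∈ Finset.univ, P x y ≠ 0 := by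
      by_contra! h
      rw [Finset.sum_eq_zero fun y hy => h y hy] at hrow
      norm_num at hrow
    refine Finset.sum_pos' (fun y _ => mul_nonneg (Matrix.nonneg_of_mem_rowStochastic hP)
      (hu y).le) ⟨y, Finset.mem_univ y, mul_pos (lt_of_le_of_ne
        (Matrix.nonneg_of_mem_rowStochastic hP) hy.symm) (hu y)⟩
  have h1 := Real.log_le_sub_one_of_pos (div_pos hpos (hu x))
  rw [Real.log_div hpos.ne' (hu x).ne'] at h1
  have h2 : ∑ y, μ x * P x y * (1 - u y / u x) = μ x * (1 - (∑ y, P x y * u y) / u x) := by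
    rw [Finset.sum_div]
    simp only [mul_sub, mul_one, Finset.sum_sub_distrib]
    rw [← Finset.mul_sum, hrow, mul_one, Finset.mul_sum]
    congr 1
    exact Finset.sum_congr rfl fun y _ => by ring
  rw [h2]
  exact mul_le_mul_of_nonneg_left (by linarith) (hμ x)

/-- For positive π this is the symmetrised product. Where π vanishes the test function takes its
maximal value, as if the density were infinite, and reversibility forbids steps into such a point
from the support of π. -/
theorem densityRoot_pair_nonneg (hP : P ∈ Matrix.rowStochastic ℝ V) (hrev : IsReversible P π)
    (hπ : ∀ x, 0 ≤ π x) (hμ : ∀ x, 0 ≤ μ x) (hκ : 0 < κ) (hM : 0 ≤ M) (x y : V) :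
    0 ≤ μ x * P x y * (1 - densityRoot π μ κ M y / densityRoot π μ κ M x) +
      μ y * P y x * (1 - densityRoot π μ κ M x / densityRoot π μ κ M y) := by
  have hupos : ∀ z, 0 < densityRoot π μ κ M z := fun z =>
    (Real.sqrt_pos.2 hκ).trans_le (sqrt_le_densityRoot hπ hμ hM z)
  have aux : ∀ x y, π x = 0 → 0 ≤ μ x * P x y *
      (1 - densityRoot π μ κ M y / densityRoot π μ κ M x) := by
    intro x y hx
    have h1 : densityRoot π μ κ M x = √(M + κ) := if_pos hx
    refine mul_nonneg (mul_nonneg (hμ x) (Matrix.nonneg_of_mem_rowStochastic hP)) ?_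
    rw [sub_nonneg, div_le_one (hupos x), h1]
    exact densityRoot_le_sqrt y
  rcases (hπ x).eq_or_lt' with hx | hx
  · rcases (hπ y).eq_or_lt' with hy | hy
    · exact add_nonneg (aux x y hx) (aux y x hy)
    · have : P y x = 0 := by
        have := hrev x y
        rw [hx, zero_mul] at this
        exact (mul_eq_zero.1 this.symm).resolve_left hy.ne'
      rw [this, mul_zero, zero_mul, add_zero]
      exact aux x y hx
  · rcases (hπ y).eq_or_lt' with hy | hy
    · have : P x y = 0 := by
        have := hrev x y
        rw [hy, zero_mul] at this
        exact (mul_eq_zero.1 this).resolve_left hx.ne'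
      rw [this, mul_zero, zero_mul, zero_add]
      exact aux y x hy
    · rw [densityRoot_pair_eq hrev hx hy _ (hupos x) (hupos y)]
      refine mul_nonneg (mul_nonneg hx.le (Matrix.nonneg_of_mem_rowStochastic hP)) ?_
      simp only [densityRoot, if_neg hx.ne', if_neg hy.ne']
      exact mul_sub_div_sqrt_nonneg (div_nonneg (hμ x) hx.le) (div_nonneg (hμ y) hy.le) hκ hM

/-- A pair along which the density drops by a factor of at least 4 contributes a fixed fraction of
its flow to the rate, so a small rate leaves little flow on such pairs. -/
theorem le_densityRoot_pair (hP : P ∈ Matrix.rowStochastic ℝ V) (hrev : IsReversible P π)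
    (hπ : ∀ x, 0 ≤ π x) (hμ : ∀ x, 0 ≤ μ x) (hκ : 0 < κ) (hM : 0 ≤ M) {x v : V}
    (hv : 0 < π v) (hMv : 4 * (μ v / π v + κ) ≤ M + κ)
    (hbad : π x = 0 ∨ 4 * (μ v / π v + κ) ≤ μ x / π x) :
    3 / 16 * (μ x * P x v) ≤
      μ x * P x v * (1 - densityRoot π μ κ M v / densityRoot π μ κ M x) +
      μ v * P v x * (1 - densityRoot π μ κ M x / densityRoot π μ κ M v) := by
  have hupos : ∀ z, 0 < densityRoot π μ κ M z := fun z =>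
    (Real.sqrt_pos.2 hκ).trans_le (sqrt_le_densityRoot hπ hμ hM z)
  have hfv : 0 ≤ μ v / π v := div_nonneg (hμ v) hv.le
  rcases (hπ x).eq_or_lt' with hx | hx
  · have h0 : P v x = 0 := by
      have := hrev x v
      rw [hx, zero_mul] at this
      exact (mul_eq_zero.1 this.symm).resolve_left hv.ne'
    rw [h0, mul_zero, zero_mul, add_zero, mul_comm]
    refine mul_le_mul_of_nonneg_left ?_
      (mul_nonneg (hμ x) (Matrix.nonneg_of_mem_rowStochastic hP))
    have h1 : densityRoot π μ κ M x = √(M + κ) := if_pos hx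
    have h2 : densityRoot π μ κ M v = √(μ v / π v + κ) := by
      simp only [densityRoot, if_neg hv.ne']
      rw [min_eq_left (by linarith)]
    have h3 : densityRoot π μ κ M v / densityRoot π μ κ M x ≤ 1 / 2 := by
      rw [div_le_iff₀ (hupos x), h1, h2]
      refine Real.sqrt_le_iff.2 ⟨by positivity, ?_⟩
      rw [mul_pow, Real.sq_sqrt (by linarith)]
      linarith
    linarith
  · have hb := hbad.resolve_left hx.ne'
    rw [densityRoot_pair_eq hrev hx hv _ (hupos x) (hupos v)]
    have h1 : 3 / 16 * (μ x * P x v) = (π x * P x v) * (3 / 16 * (μ x / π x)) := by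
      field_simp
    rw [h1]
    refine mul_le_mul_of_nonneg_left ?_
      (mul_nonneg hx.le (Matrix.nonneg_of_mem_rowStochastic hP))
    simp only [densityRoot, if_neg hx.ne', if_neg hv.ne']
    exact le_mul_sub_div_sqrt hfv hκ hb hMv

open Classical in
/-- Flow of `μ` into `G` through the pairs in `B`, compared with the flow out of `G` through the
same pairs. The first term on the right is of the order of the rate of `μ`. -/
theorem sum_flow_le (hP : P ∈ Matrix.rowStochastic ℝ V) (hrev : IsReversible P π)
    (hπ : ∀ x, 0 ≤ π x) (hμ : ∀ x, 0 ≤ μ x) (hκ : 0 < κ) (hM : 0 ≤ M) (G : Finset V)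
    (hG : ∀ v ∈ G, 0 < π v) (hGM : ∀ v ∈ G, 4 * (μ v / π v + κ) ≤ M + κ) (B : V → V → Prop) :
    ∑ x, μ x * ∑ v ∈ G, (if B x v then P x v else 0) ≤
      11 * ∑ x, μ x * (Real.log (densityRoot π μ κ M x) -
        Real.log (∑ y, P x y * densityRoot π μ κ M y)) +
      4 * ∑ v ∈ G, (μ v + κ * π v) * ∑ x, (if B x v then P v x else 0) := by
  set u := densityRoot π μ κ M with hu
  have hupos : ∀ z, 0 < u z := fun z =>
    (Real.sqrt_pos.2 hκ).trans_le (sqrt_le_densityRoot hπ hμ hM z)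
  have hPnn : ∀ x y, 0 ≤ P x y := fun x y => Matrix.nonneg_of_mem_rowStochastic hP
  set b : V → V → ℝ := fun x y =>
    μ x * P x y * (1 - u y / u x) + μ y * P y x * (1 - u x / u y) with hb
  have hbnn : ∀ x y, 0 ≤ b x y := densityRoot_pair_nonneg hP hrev hπ hμ hκ hM
  have hsumb : ∑ x, ∑ y, b x y = 2 * ∑ x, ∑ y, μ x * P x y * (1 - u y / u x) := by
    simp only [hb, Finset.sum_add_distrib]
    rw [Finset.sum_comm (f := fun x y => μ y * P y x * (1 - u x / u y))]
    ring
  have hlog := sum_mul_log_sub_ge hP hμ hupos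
  have hpt : ∀ x, ∀ v ∈ G, μ x * (if B x v then P x v else 0) ≤
      16 / 3 * b x v + 4 * ((μ v + κ * π v) * (if B x v then P v x else 0)) := by
    intro x v hv
    have hnn2 : 0 ≤ 4 * ((μ v + κ * π v) * (if B x v then P v x else 0)) := by
      have : 0 ≤ (if B x v then P v x else 0) := by split_ifs <;> simp [hPnn]
      have h2 := mul_nonneg hκ.le (hπ v)
      have h3 := hμ v
      positivity
    -- Flow from much higher density is paid for by the rate. Otherwise the density at x is below
    -- 4(μ v / π v + κ), and detailed balance turns flow into `v` into flow out of `v`.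
    by_cases hbad : π x = 0 ∨ 4 * (μ v / π v + κ) ≤ μ x / π x
    · have h1 := le_densityRoot_pair hP hrev hπ hμ hκ hM (hG v hv) (hGM v hv) hbad
      have h2 : μ x * (if B x v then P x v else 0) ≤ μ x * P x v := by
        refine mul_le_mul_of_nonneg_left ?_ (hμ x)
        split_ifs <;> simp [hPnn]
      have h3 : 3 / 16 * (μ x * P x v) ≤ b x v := h1
      linarith
    · push Not at hbad
      have hx : 0 < π x := lt_of_le_of_ne (hπ x) hbad.1.symm
      have hv' := hG v hv
      have h4 := hbnn x v
      by_cases hB : B x v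
      · simp only [if_pos hB]
        have h1 : μ x * P x v = μ x / π x * (π v * P v x) := by
          rw [← hrev x v]; field_simp
        have h2 : μ x / π x * (π v * P v x) ≤ 4 * (μ v / π v + κ) * (π v * P v x) :=
          mul_le_mul_of_nonneg_right hbad.2.le (mul_nonneg hv'.le (hPnn v x))
        have h3 : 4 * (μ v / π v + κ) * (π v * P v x) = 4 * ((μ v + κ * π v) * P v x) := by
          field_simp
        linarith
      · simp only [if_neg hB, mul_zero, add_zero]
        linarith
  calc ∑ x, μ x * ∑ v ∈ G, (if B x v then P x v else 0)
      = ∑ x, ∑ v ∈ G, μ x * (if B x v then P x v else 0) := by simp only [Finset.mul_sum]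
    _ ≤ ∑ x, ∑ v ∈ G, (16 / 3 * b x v +
          4 * ((μ v + κ * π v) * (if B x v then P v x else 0))) :=
        Finset.sum_le_sum fun x _ => Finset.sum_le_sum fun v hv => hpt x v hv
    _ = 16 / 3 * ∑ x, ∑ v ∈ G, b x v +
          4 * ∑ v ∈ G, (μ v + κ * π v) * ∑ x, (if B x v then P v x else 0) := by
        simp only [Finset.sum_add_distrib, ← Finset.mul_sum]
        rw [Finset.sum_comm (t := G)
          (f := fun x v => (μ v + κ * π v) * (if B x v then P v x else 0))]
        simp only [Finset.mul_sum]
    -- Each unordered pair enters `b` twice, so the constant is 2 · 16/3 = 32/3, rounded up to 11;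
    -- this uses that the total is nonnegative.
    _ ≤ _ := by
        have h1 : ∑ x, ∑ v ∈ G, b x v ≤ ∑ x, ∑ y, b x y :=
          Finset.sum_le_sum fun x _ => Finset.sum_le_sum_of_subset_of_nonneg
            (Finset.subset_univ G) fun y _ _ => hbnn x y
        have h2 : 0 ≤ ∑ x, ∑ y, b x y :=
          Finset.sum_nonneg fun x _ => Finset.sum_nonneg fun y _ => hbnn x y
        linarith

end Ratio

/-! ### The occupation measure of the weighted chain. -/

section NearMass

variable {V : Type*} [Fintype V] [DecidableEq V] {p : Matrix V V ℝ} {π : V → ℝ}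

theorem IsReversible.pow (h : IsReversible p π) (k : ℕ) : IsReversible (p ^ k) π := by
  induction k with
  | zero =>
    intro u v
    simp only [pow_zero, Matrix.one_apply]
    by_cases huv : u = v
    · simp [huv]
    · simp [huv, Ne.symm huv]
  | succ k ih =>
    intro u v
    rw [pow_succ, Matrix.mul_apply, ← pow_succ, pow_succ', Matrix.mul_apply, Finset.mul_sum,
      Finset.mul_sum]
    refine Finset.sum_congr rfl fun z _ => ?_
    calc π u * ((p ^ k) u z * p z v) = (π u * (p ^ k) u z) * p z v := by ring
      _ = (π z * p z v) * (p ^ k) z u := by rw [ih u z]; ring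
      _ = π v * (p v z * (p ^ k) z u) := by rw [h z v]; ring

/-- Replacing a sum along the path by a sum along the path shifted by `s`. -/
theorem sum_range_sub_le_sum_range_add {F : ℕ → ℝ} {H : ℝ} (hF : ∀ a b, F a ≤ F b + H) (N s : ℕ) :
    ∑ t ∈ Finset.range N, F t - s * H ≤ ∑ t ∈ Finset.range N, F (t + s) := by
  have h1 : ∑ t ∈ Finset.range (N + s), F t =
      ∑ t ∈ Finset.range N, F t + ∑ t ∈ Finset.range s, F (N + t) := Finset.sum_range_add _ _ _
  have h2 : ∑ t ∈ Finset.range (s + N), F t =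
      ∑ t ∈ Finset.range s, F t + ∑ t ∈ Finset.range N, F (s + t) := Finset.sum_range_add _ _ _
  have h3 : ∑ t ∈ Finset.range s, F t ≤ ∑ t ∈ Finset.range s, (F (N + t) + H) :=
    Finset.sum_le_sum fun t _ => hF _ _
  rw [Finset.sum_add_distrib, Finset.sum_const, Finset.card_range, nsmul_eq_mul] at h3
  rw [add_comm s N] at h2
  simp only [add_comm _ s]
  linarith

/-- The rate of the occupation measure of the chain, conditioned on an event that is not too
unlikely, is small. -/
theorem pathExp_mul_sum_log_sub_le (hp : p ∈ Matrix.rowStochastic ℝ V) {w : (ℕ → V) → ℝ}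
    {s M T : ℕ} {x : V} (hT : (M + 1) * s ≤ T) (hw0 : ∀ ω, 0 ≤ w ω) (hw1 : ∀ ω, w ω ≤ 1)
    (hw : 0 < pathExp p T x w) {u : V → ℝ} (hu : ∀ x, 0 < u x) {H : ℝ}
    (hH : ∀ a b, Real.log (u a) ≤ Real.log (u b) + H) :
    pathExp p T x (fun ω => w ω * ∑ t ∈ Finset.range (M * s),
      (Real.log (u (ω t)) - Real.log (∑ y, (p ^ s) (ω t) y * u y))) ≤
      pathExp p T x w * (s * (H - Real.log (pathExp p T x w))) := by
  -- With u evaluated at the end of the window, e^g has mean exactly 1, so the entropy inequality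
  -- applies with c = 0. Moving u back to the start of the window costs the boundary term `s * H`.
  set g : (ℕ → V) → ℝ := fun ω =>
    Real.log (u (ω s)) - Real.log (∑ y, (p ^ s) (ω 0) y * u y) with hg
  have hdep : DependsOn g (Set.Iic s) := by
    intro ω ω' h
    simp only [hg, h 0 (Set.mem_Iic.2 (Nat.zero_le _)), h s (Set.mem_Iic.2 le_rfl)]
  have hps := pow_mem hp s
  have hpos : ∀ y, 0 < ∑ z, (p ^ s) y z * u z := by
    intro y
    have hrow := Matrix.sum_row_of_mem_rowStochastic hps y
    obtain ⟨z, -, hz⟩ : ∃ z ∈ Finset.univ, (p ^ s) y z ≠ 0 := by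
      by_contra! h
      rw [Finset.sum_eq_zero fun z hz => h z hz] at hrow
      norm_num at hrow
    exact Finset.sum_pos' (fun z _ => mul_nonneg (Matrix.nonneg_of_mem_rowStochastic hps)
      (hu z).le) ⟨z, Finset.mem_univ z, mul_pos (lt_of_le_of_ne
        (Matrix.nonneg_of_mem_rowStochastic hps) hz.symm) (hu z)⟩
  have hexp : ∀ y, pathExp p s y (fun ω => Real.exp (g ω)) ≤ Real.exp 0 := by
    intro y
    have h1 : pathExp p s y (fun ω => Real.exp (g ω)) =
        pathExp p s y (fun ω => (∑ z, (p ^ s) y z * u z)⁻¹ * u (ω s)) := by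
      refine pathExp_congr _ _ fun ω h => ?_
      simp only [hg, h]
      rw [Real.exp_sub, Real.exp_log (hu _), Real.exp_log (hpos y), div_eq_inv_mul]
    rw [h1, pathExp_mul_left, pathExp_apply, Real.exp_zero, inv_mul_cancel₀ (hpos y).ne']
  have h1 := pathExp_mul_sum_shift_le hp hT hw0 hw1 hw hdep hexp
  have h2 : pathExp p T x (fun ω => w ω * ∑ t ∈ Finset.range (M * s),
      (Real.log (u (ω t)) - Real.log (∑ y, (p ^ s) (ω t) y * u y))) - pathExp p T x w * (s * H) ≤
      pathExp p T x (fun ω => w ω * ∑ t ∈ Finset.range (M * s), g (pathShift t ω)) := by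
    rw [← pathExp_mul_right, ← pathExp_sub]
    refine pathExp_mono hp _ _ fun ω _ => ?_
    rw [← mul_sub]
    refine mul_le_mul_of_nonneg_left ?_ (hw0 ω)
    have h3 := sum_range_sub_le_sum_range_add (F := fun t => Real.log (u (ω t))) (H := H)
      (fun a b => hH _ _) (M * s) s
    simp only [hg, pathShift, Finset.sum_sub_distrib, Nat.add_zero]
    linarith
  simp only [mul_zero, zero_sub] at h1
  linarith

open Classical in
/-- Under the conditioned law, the flow into `G` through the pairs in `B` is controlled by the
chain's own flow out of `G` through these pairs. -/
theorem pathExp_mul_sum_flow_le (hp : p ∈ Matrix.rowStochastic ℝ V) (hrev : IsReversible p π)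
    (hπ : ∀ x, 0 ≤ π x) {w : (ℕ → V) → ℝ} {s M T : ℕ} {x : V} (hT : (M + 1) * s ≤ T)
    (hT0 : 0 < T) (hw0 : ∀ ω, 0 ≤ w ω) (hw1 : ∀ ω, w ω ≤ 1)
    (hw : 0 < pathExp p T x w) {W : Finset V} {K : ℝ} (hW : ∀ v ∈ W, 0 < π v)
    (hWne : W.Nonempty) (hK : ∀ v ∈ W, ∀ v' ∈ W, π v ≤ K * π v') {G : Finset V} (hGW : G ⊆ W)
    {B : V → V → Prop} {η : ℝ} (hη0 : 0 ≤ η)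
    (hη : ∀ v ∈ G, ∑ y, (if B y v then (p ^ s) v y else 0) ≤ η) :
    pathExp p T x (fun ω => w ω * ∑ t ∈ Finset.range (M * s),
      ∑ v ∈ G, (if B (ω t) v then (p ^ s) (ω t) v else 0)) ≤
      pathExp p T x w * (11 * (s * (Real.log (4 * K * Fintype.card V + 4) -
        Real.log (pathExp p T x w))) + 8 * η * T) := by
  set A := pathExp p T x w with hA
  set N := M * s with hN
  have hNT : N ≤ T := by nlinarith
  -- The unnormalised occupation measure under the weight, of total mass `A * N`.
  set μ : V → ℝ := fun y =>
    pathExp p T x (fun ω => w ω * ∑ t ∈ Finset.range N, if ω t = y then 1 else 0) with hμdef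
  have hμ : ∀ y, 0 ≤ μ y := fun y => pathExp_nonneg hp _ _ fun ω _ =>
    mul_nonneg (hw0 ω) (Finset.sum_nonneg fun t _ => by split_ifs <;> norm_num)
  have hμf : ∀ f : V → ℝ, ∑ y, μ y * f y =
      pathExp p T x (fun ω => w ω * ∑ t ∈ Finset.range N, f (ω t)) := by
    intro f
    simp only [hμdef, ← pathExp_mul_right]
    rw [← pathExp_sum]
    refine pathExp_congr _ _ fun ω _ => ?_
    simp only [mul_assoc]
    rw [← Finset.mul_sum]
    congr 1
    simp only [Finset.sum_mul]
    rw [Finset.sum_comm]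
    refine Finset.sum_congr rfl fun t _ => ?_
    simp
  have hμsum : ∑ y, μ y = A * N := by
    have := hμf (fun _ => 1)
    simp only [mul_one, Finset.sum_const, Finset.card_range, nsmul_eq_mul] at this
    rw [this, pathExp_mul_right]
  have hπW : 0 < ∑ v ∈ W, π v := Finset.sum_pos hW hWne
  have hTpos : (0 : ℝ) < T := by exact_mod_cast hT0
  have hNT' : (N : ℝ) ≤ T := by exact_mod_cast hNT
  -- The floor κ gives κ π the mass A T on `W`, comparable to the mass of μ, so adding κ π at most
  -- doubles the final bound.
  set κ := A * T / ∑ v ∈ W, π v with hκdef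
  have hκ : 0 < κ := div_pos (mul_pos hw hTpos) hπW
  have hκW : κ * ∑ v ∈ W, π v = A * T := div_mul_cancel₀ _ hπW.ne'
  have hK1 : 1 ≤ K := by
    obtain ⟨v, hv⟩ := hWne
    have h1 := hK v hv v hv
    have h2 := hW v hv
    by_contra hlt
    push Not at hlt
    nlinarith
  set n : ℝ := ((Fintype.card V : ℕ) : ℝ) with hn
  have hn0 : 0 ≤ n := Nat.cast_nonneg _
  -- On `W` the ratio μ/π is at most κ K n, because π is comparable there up to the factor K. This
  -- cap thus leaves the required room above the densities on `G`, while log u oscillates only by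
  -- O(log n).
  set Mx := κ * (4 * K * n + 3) with hMx
  have hKn : 0 ≤ K * n := by positivity
  have hMx0 : 0 ≤ Mx := mul_nonneg hκ.le (by linarith)
  have hGM : ∀ v ∈ G, 4 * (μ v / π v + κ) ≤ Mx + κ := by
    intro v hv
    have hvpos := hW v (hGW hv)
    have h1 : μ v ≤ A * T := by
      calc μ v ≤ ∑ y, μ y := Finset.single_le_sum (fun y _ => hμ y) (Finset.mem_univ v)
        _ = A * N := hμsum
        _ ≤ A * T := mul_le_mul_of_nonneg_left hNT' hw.le
    have h2 : ∑ v' ∈ W, π v' ≤ n * (K * π v) := by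
      calc ∑ v' ∈ W, π v' ≤ ∑ v' ∈ W, K * π v :=
            Finset.sum_le_sum fun v' hv' => hK v' hv' v (hGW hv)
        _ = W.card * (K * π v) := by rw [Finset.sum_const, nsmul_eq_mul]
        _ ≤ n * (K * π v) := by
            refine mul_le_mul_of_nonneg_right ?_ (by positivity)
            exact Nat.cast_le.2 (Finset.card_le_univ W)
    have h3 : μ v / π v ≤ κ * (K * n) := by
      rw [div_le_iff₀ hvpos]
      calc μ v ≤ A * T := h1
        _ = κ * ∑ v ∈ W, π v := hκW.symm
        _ ≤ κ * (n * (K * π v)) := mul_le_mul_of_nonneg_left h2 hκ.le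
        _ = κ * (K * n) * π v := by ring
    rw [hMx]
    nlinarith
  have hu : ∀ z, 0 < densityRoot π μ κ Mx z := fun z =>
    (Real.sqrt_pos.2 hκ).trans_le (sqrt_le_densityRoot hπ hμ hMx0 z)
  have hH : ∀ a b, Real.log (densityRoot π μ κ Mx a) ≤
      Real.log (densityRoot π μ κ Mx b) + Real.log (4 * K * n + 4) := by
    intro a b
    rw [← Real.log_mul (hu b).ne' (by nlinarith)]
    refine Real.log_le_log (hu a) ?_
    have h4 : (1 : ℝ) ≤ 4 * K * n + 4 := by nlinarith
    calc densityRoot π μ κ Mx a ≤ √(Mx + κ) := densityRoot_le_sqrt a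
      _ = √κ * √(4 * K * n + 4) := by
          rw [← Real.sqrt_mul hκ.le, hMx]; ring_nf
      _ ≤ √κ * (4 * K * n + 4) := by
          refine mul_le_mul_of_nonneg_left ?_ (Real.sqrt_nonneg _)
          exact Real.sqrt_le_iff.2 ⟨by linarith, by nlinarith⟩
      _ ≤ _ := mul_le_mul_of_nonneg_right (sqrt_le_densityRoot hπ hμ hMx0 b) (by linarith)
  have hflow := sum_flow_le (pow_mem hp s) (hrev.pow s) hπ hμ hκ hMx0 G
    (fun v hv => hW v (hGW hv)) hGM B
  have hrate := pathExp_mul_sum_log_sub_le hp hT hw0 hw1 hw hu hH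
  rw [← hμf (fun y => Real.log (densityRoot π μ κ Mx y) -
    Real.log (∑ z, (p ^ s) y z * densityRoot π μ κ Mx z))] at hrate
  rw [hμf (fun y => ∑ v ∈ G, (if B y v then (p ^ s) y v else 0))] at hflow
  have hlast : ∑ v ∈ G, (μ v + κ * π v) * ∑ y, (if B y v then (p ^ s) v y else 0) ≤
      2 * (A * T) * η := by
    calc _ ≤ ∑ v ∈ G, (μ v + κ * π v) * η := Finset.sum_le_sum fun v hv =>
          mul_le_mul_of_nonneg_left (hη v hv)
            (add_nonneg (hμ v) (mul_nonneg hκ.le (hπ v)))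
      _ = (∑ v ∈ G, μ v + κ * ∑ v ∈ G, π v) * η := by
          rw [← Finset.sum_mul, Finset.sum_add_distrib, Finset.mul_sum]
      _ ≤ 2 * (A * T) * η := by
          refine mul_le_mul_of_nonneg_right ?_ hη0
          have h1 : ∑ v ∈ G, μ v ≤ A * T := by
            calc ∑ v ∈ G, μ v ≤ ∑ v, μ v := Finset.sum_le_sum_of_subset_of_nonneg
                  (Finset.subset_univ G) fun v _ _ => hμ v
              _ = A * N := hμsum
              _ ≤ A * T := mul_le_mul_of_nonneg_left hNT' hw.le
          have h2 : κ * ∑ v ∈ G, π v ≤ A * T := by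
            rw [← hκW]
            exact mul_le_mul_of_nonneg_left (Finset.sum_le_sum_of_subset_of_nonneg hGW
              fun v _ _ => hπ v) hκ.le
          linarith
  calc _ ≤ _ := hflow
    _ ≤ 11 * (A * (s * (Real.log (4 * K * n + 4) - Real.log A))) + 4 * (2 * (A * T) * η) := by
        linarith
    _ = _ := by ring

end NearMass

/-! ### Hitting probabilities over a block and the near mass. -/

section Hitting

open Classical

variable {V : Type*} [Fintype V] [DecidableEq V] {p : Matrix V V ℝ}

/-- The probability that the chain started at `x` is at `v` at one of the times `1, …, L`. -/
noncomputable def hitProb (p : Matrix V V ℝ) (L : ℕ) (x v : V) : ℝ :=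
  pathExp p L x (fun ω => if ∃ t, 1 ≤ t ∧ t ≤ L ∧ ω t = v then 1 else 0)

theorem hitProb_nonneg (hp : p ∈ Matrix.rowStochastic ℝ V) (L : ℕ) (x v : V) :
    0 ≤ hitProb p L x v :=
  pathExp_nonneg hp _ _ fun ω _ => by split_ifs <;> norm_num

theorem card_filter_exists_le {V : Type*} [DecidableEq V] (G : Finset V) (L : ℕ) (ω : ℕ → V) :
    (G.filter (fun v => ∃ t, 1 ≤ t ∧ t ≤ L ∧ ω t = v)).card ≤ L := by
  calc _ ≤ ((Finset.Icc 1 L).image ω).card := by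
        refine Finset.card_le_card fun v hv => ?_
        obtain ⟨-, t, h1, h2, h3⟩ := Finset.mem_filter.1 hv
        exact Finset.mem_image.2 ⟨t, Finset.mem_Icc.2 ⟨h1, h2⟩, h3⟩
    _ ≤ (Finset.Icc 1 L).card := Finset.card_image_le
    _ = L := by simp

theorem sum_hitProb_le (hp : p ∈ Matrix.rowStochastic ℝ V) (L : ℕ) (x : V) (G : Finset V) :
    ∑ v ∈ G, hitProb p L x v ≤ L := by
  unfold hitProb
  rw [← pathExp_sum]
  refine pathExp_le_of_le hp _ _ fun ω _ => ?_
  rw [Finset.sum_boole]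
  exact_mod_cast card_filter_exists_le G L ω

theorem hitProb_le_sum_pow (hp : p ∈ Matrix.rowStochastic ℝ V) (L : ℕ) (x v : V) :
    hitProb p L x v ≤ ∑ r ∈ Finset.Icc 1 L, (p ^ r) x v := by
  have h : ∑ r ∈ Finset.Icc 1 L, (p ^ r) x v =
      pathExp p L x (fun ω => ∑ r ∈ Finset.Icc 1 L, if ω r = v then 1 else 0) := by
    rw [pathExp_sum]
    refine Finset.sum_congr rfl fun r hr => ?_
    rw [pathExp_apply_of_le hp (Finset.mem_Icc.1 hr).2 x (fun y => if y = v then 1 else 0)]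
    simp
  rw [h]
  refine pathExp_mono hp _ _ fun ω _ => ?_
  split_ifs with hω
  · obtain ⟨t, h1, h2, h3⟩ := hω
    have h4 : (if ω t = v then (1 : ℝ) else 0) ≤ ∑ r ∈ Finset.Icc 1 L, if ω r = v then 1 else 0 :=
      Finset.single_le_sum (f := fun r => if ω r = v then (1 : ℝ) else 0)
        (fun r _ => by split_ifs <;> norm_num) (Finset.mem_Icc.2 ⟨h1, h2⟩)
    rwa [if_pos h3] at h4
  · exact Finset.sum_nonneg fun r _ => by split_ifs <;> norm_num

/-- If the chain started at `v` is unlikely to be back at `v` after more than `l` steps, then after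
`s ≥ l` steps it is unlikely to be at a place from which `v` is easily hit. -/
theorem sum_pow_near_le (hp : p ∈ Matrix.rowStochastic ℝ V) {L l s : ℕ} (hls : l ≤ s)
    (hsL : s ≤ L) {v : V} {θ δ : ℝ} (hδ : 0 < δ)
    (hθ : ∑ k ∈ Finset.Ioc l (2 * L), (p ^ k) v v ≤ θ) :
    ∑ y, (if δ < hitProb p L y v then (p ^ s) v y else 0) ≤ θ / δ := by
  have hnn : ∀ k x y, 0 ≤ (p ^ k) x y := fun k x y =>
    Matrix.nonneg_of_mem_rowStochastic (pow_mem hp k)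
  rw [le_div_iff₀ hδ, Finset.sum_mul]
  calc ∑ y, (if δ < hitProb p L y v then (p ^ s) v y else 0) * δ
      ≤ ∑ y, (p ^ s) v y * ∑ r ∈ Finset.Icc 1 L, (p ^ r) y v := by
        refine Finset.sum_le_sum fun y _ => ?_
        split_ifs with h
        · exact mul_le_mul_of_nonneg_left (h.le.trans (hitProb_le_sum_pow hp L y v)) (hnn _ _ _)
        · rw [zero_mul]
          exact mul_nonneg (hnn _ _ _) (Finset.sum_nonneg fun r _ => hnn _ _ _)
    _ = ∑ r ∈ Finset.Icc 1 L, (p ^ (s + r)) v v := by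
        simp only [Finset.mul_sum]
        rw [Finset.sum_comm]
        refine Finset.sum_congr rfl fun r _ => ?_
        rw [pow_add, Matrix.mul_apply]
    _ = ∑ k ∈ (Finset.Icc 1 L).map (addLeftEmbedding s), (p ^ k) v v := by
        rw [Finset.sum_map]; rfl
    _ ≤ ∑ k ∈ Finset.Ioc l (2 * L), (p ^ k) v v := by
        refine Finset.sum_le_sum_of_subset_of_nonneg ?_ fun k _ _ => hnn _ _ _
        intro k hk
        simp only [Finset.mem_map, Finset.mem_Icc, addLeftEmbedding_apply] at hk
        obtain ⟨r, hr, rfl⟩ := hk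
        rw [Finset.mem_Ioc]
        omega
    _ ≤ θ := hθ

/-- The expected number of vertices of `G` hit within `L` steps from `x`, among those that are
individually hit with probability more than `δ`. -/
noncomputable def nearMass (p : Matrix V V ℝ) (L : ℕ) (δ : ℝ) (G : Finset V) (x : V) : ℝ :=
  ∑ v ∈ G, if δ < hitProb p L x v then hitProb p L x v else 0

theorem nearMass_nonneg (hp : p ∈ Matrix.rowStochastic ℝ V) (L : ℕ) (δ : ℝ) (G : Finset V)
    (x : V) : 0 ≤ nearMass p L δ G x :=
  Finset.sum_nonneg fun v _ => by
    split_ifs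
    · exact hitProb_nonneg hp L x v
    · exact le_rfl

/-- Union bound over the time of the hit. Each of the first `l` times costs at most 1, since rows
sum to 1; the flow comparison is needed only for the later ones. -/
theorem nearMass_le (hp : p ∈ Matrix.rowStochastic ℝ V) {L l : ℕ} (hl : l ≤ L) (δ : ℝ)
    (G : Finset V) (x : V) :
    nearMass p L δ G x ≤ l + ∑ s ∈ Finset.Ioc l L,
      ∑ v ∈ G, (if δ < hitProb p L x v then (p ^ s) x v else 0) := by
  have hnn : ∀ k x y, 0 ≤ (p ^ k) x y := fun k x y =>
    Matrix.nonneg_of_mem_rowStochastic (pow_mem hp k)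
  have h1 : nearMass p L δ G x ≤ ∑ s ∈ Finset.Ioc 0 L,
      ∑ v ∈ G, (if δ < hitProb p L x v then (p ^ s) x v else 0) := by
    rw [Finset.sum_comm]
    refine Finset.sum_le_sum fun v _ => ?_
    split_ifs
    · exact hitProb_le_sum_pow hp L x v
    · simp
  refine h1.trans ?_
  rw [← Finset.sum_Ioc_consecutive _ (Nat.zero_le l) hl]
  refine add_le_add_left ?_ _
  calc ∑ s ∈ Finset.Ioc 0 l, ∑ v ∈ G, (if δ < hitProb p L x v then (p ^ s) x v else 0)
      ≤ ∑ s ∈ Finset.Ioc 0 l, (1 : ℝ) := by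
        refine Finset.sum_le_sum fun s _ => ?_
        calc ∑ v ∈ G, (if δ < hitProb p L x v then (p ^ s) x v else 0)
            ≤ ∑ v ∈ G, (p ^ s) x v := Finset.sum_le_sum fun v _ => by
              split_ifs
              · exact le_rfl
              · exact hnn _ _ _
          _ ≤ ∑ v, (p ^ s) x v := Finset.sum_le_sum_of_subset_of_nonneg
              (Finset.subset_univ G) fun v _ _ => hnn _ _ _
          _ = 1 := Matrix.sum_row_of_mem_rowStochastic (pow_mem hp s) x
    _ = l := by simp

/-- The flow bound is applied to each lag s in (l, L] with B the near pairs; there the flow out of a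
vertex of `G` is at most θ/δ by `sum_pow_near_le`. -/
theorem pathExp_mul_sum_nearMass_le (hp : p ∈ Matrix.rowStochastic ℝ V) {π : V → ℝ}
    (hrev : IsReversible p π) (hπ : ∀ x, 0 ≤ π x) {w : (ℕ → V) → ℝ} {T : ℕ} {x : V}
    (hT0 : 0 < T) (hw0 : ∀ ω, 0 ≤ w ω) (hw1 : ∀ ω, w ω ≤ 1)
    (hw : 0 < pathExp p T x w) {W : Finset V} {K : ℝ} (hW : ∀ v ∈ W, 0 < π v)
    (hWne : W.Nonempty) (hK : ∀ v ∈ W, ∀ v' ∈ W, π v ≤ K * π v') {G : Finset V} (hGW : G ⊆ W)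
    {L l : ℕ} (hlL : l ≤ L) {θ δ : ℝ} (hδ : 0 < δ) (hθ0 : 0 ≤ θ)
    (hθ : ∀ v ∈ G, ∑ k ∈ Finset.Ioc l (2 * L), (p ^ k) v v ≤ θ) {R : ℝ}
    (hR : Real.log (4 * K * Fintype.card V + 4) - Real.log (pathExp p T x w) ≤ R) (hR0 : 0 ≤ R)
    {N : ℕ} (hN : N + 2 * L ≤ T) :
    pathExp p T x (fun ω => w ω * ∑ t ∈ Finset.range N, nearMass p L δ G (ω t)) ≤
      pathExp p T x w * (T * l + L * (11 * L * R + 8 * (θ / δ) * T)) := by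
  set A := pathExp p T x w with hA
  have hTnn : (0 : ℝ) ≤ T := Nat.cast_nonneg T
  have hnn : ∀ s (y : V), 0 ≤ ∑ v ∈ G, (if δ < hitProb p L y v then (p ^ s) y v else 0) :=
    fun s y => Finset.sum_nonneg fun v _ => by
      split_ifs
      · exact Matrix.nonneg_of_mem_rowStochastic (pow_mem hp s)
      · exact le_rfl
  have hs : ∀ s ∈ Finset.Ioc l L, pathExp p T x (fun ω => w ω * ∑ t ∈ Finset.range N,
      ∑ v ∈ G, (if δ < hitProb p L (ω t) v then (p ^ s) (ω t) v else 0)) ≤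
      A * (11 * L * R + 8 * (θ / δ) * T) := by
    intro s hs
    obtain ⟨hs1, hs2⟩ := Finset.mem_Ioc.1 hs
    have hs0 : 0 < s := by omega
    have hdm := Nat.div_add_mod T s
    have hmod := Nat.mod_lt T hs0
    -- Then (M + 1)s ≤ T < (M + 2)s, so the times below M s include all those below `N` because N +
    -- 2L ≤ T.
    obtain ⟨M, hM⟩ : ∃ M, T / s = M + 1 := by
      have : 1 ≤ T / s := (Nat.one_le_div_iff hs0).2 (by omega)
      exact ⟨T / s - 1, by omega⟩
    rw [hM] at hdm
    have hT : (M + 1) * s ≤ T := by rw [mul_comm]; omega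
    have hNM : N ≤ M * s := by
      have : s * (M + 1) = M * s + s := by ring
      omega
    have h1 := pathExp_mul_sum_flow_le hp hrev hπ hT hT0 hw0 hw1 hw hW hWne hK hGW
      (B := fun y v => δ < hitProb p L y v) (η := θ / δ) (div_nonneg hθ0 hδ.le)
      (fun v hv => sum_pow_near_le hp hs1.le hs2 hδ (hθ v hv))
    refine le_trans (pathExp_mono hp _ _ fun ω _ => mul_le_mul_of_nonneg_left ?_ (hw0 ω))
      (h1.trans (mul_le_mul_of_nonneg_left ?_ hw.le))
    · exact Finset.sum_le_sum_of_subset_of_nonneg (Finset.range_subset_range.2 hNM)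
        fun t _ _ => hnn s (ω t)
    · have h2 : (s : ℝ) ≤ L := by exact_mod_cast hs2
      have h3 : (s : ℝ) * (Real.log (4 * K * Fintype.card V + 4) - Real.log A) ≤ L * R :=
        (mul_le_mul_of_nonneg_left hR (Nat.cast_nonneg s)).trans
          (mul_le_mul_of_nonneg_right h2 hR0)
      linarith
  have hbase : 0 ≤ 11 * L * R + 8 * (θ / δ) * T := by positivity
  calc pathExp p T x (fun ω => w ω * ∑ t ∈ Finset.range N, nearMass p L δ G (ω t))
      ≤ pathExp p T x (fun ω => w ω * (T * l) + ∑ s ∈ Finset.Ioc l L,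
          w ω * ∑ t ∈ Finset.range N,
            ∑ v ∈ G, (if δ < hitProb p L (ω t) v then (p ^ s) (ω t) v else 0)) := by
        refine pathExp_mono hp _ _ fun ω _ => ?_
        rw [← Finset.mul_sum, ← mul_add]
        refine mul_le_mul_of_nonneg_left ?_ (hw0 ω)
        refine (Finset.sum_le_sum fun t _ => nearMass_le hp hlL δ G (ω t)).trans ?_
        rw [Finset.sum_add_distrib, Finset.sum_comm (s := Finset.range N), Finset.sum_const,
          Finset.card_range, nsmul_eq_mul]
        refine add_le_add_left ?_ _
        refine mul_le_mul_of_nonneg_right ?_ (Nat.cast_nonneg l)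
        exact_mod_cast (by omega : N ≤ T)
    _ = A * (T * l) + ∑ s ∈ Finset.Ioc l L, pathExp p T x (fun ω => w ω * ∑ t ∈ Finset.range N,
            ∑ v ∈ G, (if δ < hitProb p L (ω t) v then (p ^ s) (ω t) v else 0)) := by
        rw [pathExp_add, pathExp_mul_right, pathExp_sum]
    _ ≤ A * (T * l) + ∑ s ∈ Finset.Ioc l L, A * (11 * L * R + 8 * (θ / δ) * T) :=
        add_le_add_right (Finset.sum_le_sum hs) _
    _ ≤ A * (T * l) + L * (A * (11 * L * R + 8 * (θ / δ) * T)) := by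
        rw [Finset.sum_const, Nat.card_Ioc, nsmul_eq_mul]
        refine add_le_add_right (mul_le_mul_of_nonneg_right ?_ (mul_nonneg hw.le hbase)) _
        exact_mod_cast Nat.sub_le L l
    _ = _ := by ring

/-- For some offset, the conditioned chain observed at multiples of `L` has small near mass with
conditional probability at least one half. -/
theorem exists_offset_nearMass_le (hp : p ∈ Matrix.rowStochastic ℝ V) {π : V → ℝ}
    (hrev : IsReversible p π) (hπ : ∀ x, 0 ≤ π x) {w : (ℕ → V) → ℝ} {T : ℕ} {x : V}
    (hT0 : 0 < T) (hw0 : ∀ ω, 0 ≤ w ω) (hw1 : ∀ ω, w ω ≤ 1)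
    (hw : 0 < pathExp p T x w) {W : Finset V} {K : ℝ} (hW : ∀ v ∈ W, 0 < π v)
    (hWne : W.Nonempty) (hK : ∀ v ∈ W, ∀ v' ∈ W, π v ≤ K * π v') {G : Finset V} (hGW : G ⊆ W)
    {L l : ℕ} (hl : 0 < l) (hlL : l ≤ L) {θ δ : ℝ} (hδ : 0 < δ) (hθ0 : 0 ≤ θ)
    (hθ : ∀ v ∈ G, ∑ k ∈ Finset.Ioc l (2 * L), (p ^ k) v v ≤ θ) {R : ℝ}
    (hR : Real.log (4 * K * Fintype.card V + 4) - Real.log (pathExp p T x w) ≤ R) (hR0 : 0 ≤ R)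
    {J : ℕ} (hJ : J * L + 2 * L ≤ T) :
    ∃ o < L, pathExp p T x w / 2 ≤ pathExp p T x (fun ω => w ω *
      if ∑ j ∈ Finset.range J, nearMass p L δ G (ω (o + j * L)) ≤
        2 * (T * l / L + 11 * L * R + 8 * (θ / δ) * T) then 1 else 0) := by
  have hL : (0 : ℝ) < L := by exact_mod_cast (by omega : 0 < L)
  have hTpos : (0 : ℝ) < T := by exact_mod_cast hT0
  have hlpos : (0 : ℝ) < l := by exact_mod_cast hl
  set A := pathExp p T x w with hA
  set b := T * l / L + 11 * L * R + 8 * (θ / δ) * T with hb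
  have hbpos : 0 < b := by
    have : 0 < T * l / (L : ℝ) := by positivity
    have h2 : 0 ≤ 11 * L * R := by positivity
    have h3 : 0 ≤ 8 * (θ / δ) * T := by positivity
    linarith
  have htot := pathExp_mul_sum_nearMass_le hp hrev hπ hT0 hw0 hw1 hw hW hWne hK hGW hlL hδ hθ0 hθ
    hR hR0 hJ
  have hAb : A * (T * l + L * (11 * L * R + 8 * (θ / δ) * T)) = L * (A * b) := by
    rw [hb]; field_simp; ring
  rw [hAb] at htot
  simp only [sum_range_mul_eq_sum_sum, Finset.mul_sum (Finset.range L)] at htot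
  rw [pathExp_sum] at htot
  -- The bound for all times is L · (A b), so one of the L offsets is at most average.
  obtain ⟨o, ho, hoff⟩ : ∃ o ∈ Finset.range L, pathExp p T x (fun ω => w ω *
      ∑ j ∈ Finset.range J, nearMass p L δ G (ω (o + j * L))) ≤ A * b := by
    by_contra! h
    have h1 := Finset.sum_lt_sum_of_nonempty
      (Finset.nonempty_range_iff.2 (by omega : L ≠ 0)) h
    rw [Finset.sum_const, Finset.card_range, nsmul_eq_mul] at h1
    linarith
  refine ⟨o, Finset.mem_range.1 ho, ?_⟩
  -- Markov's inequality at twice the mean, under the weighted law.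
  have hmarkov : (2 * b) * (A - pathExp p T x (fun ω => w ω *
      if ∑ j ∈ Finset.range J, nearMass p L δ G (ω (o + j * L)) ≤ 2 * b then 1 else 0)) ≤
      A * b := by
    refine le_trans ?_ hoff
    rw [hA, ← pathExp_sub, ← pathExp_mul_left]
    refine pathExp_mono hp _ _ fun ω _ => ?_
    have hnn : 0 ≤ ∑ j ∈ Finset.range J, nearMass p L δ G (ω (o + j * L)) :=
      Finset.sum_nonneg fun j _ => nearMass_nonneg hp L δ G _
    split_ifs with h
    · simp only [mul_one, sub_self, mul_zero]
      exact mul_nonneg (hw0 ω) hnn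
    · push Not at h
      simp only [mul_zero, sub_zero]
      rw [mul_comm]
      exact mul_le_mul_of_nonneg_left h.le (hw0 ω)
  nlinarith

end Hitting

/-- Empirical approximation of an average by a sample of size `m`, by greedy choice. -/
theorem exists_sym_sum_sq_le {V ι : Type*} (x : ℕ → V) (f : V → ι → ℝ) (G : Finset ι) {J : ℕ}
    (hJ : 0 < J) {c : ℝ} (hc : ∀ y, ∑ v ∈ G, f y v ^ 2 ≤ c) (m : ℕ) :
    ∃ σ : Sym V m, ∑ v ∈ G, (((σ : Multiset V).map fun y => f y v).sum -
      m / J * ∑ j ∈ Finset.range J, f (x j) v) ^ 2 ≤ m * c := by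
  have hJ' : (0 : ℝ) < J := by exact_mod_cast hJ
  induction m with
  | zero => exact ⟨Sym.nil, by simp⟩
  | succ m ih =>
    obtain ⟨σ, hσ⟩ := ih
    set A : ι → ℝ := fun v => ((σ : Multiset V).map fun y => f y v).sum -
      m / J * ∑ j ∈ Finset.range J, f (x j) v with hA
    set a : ι → ℝ := fun v => (∑ j ∈ Finset.range J, f (x j) v) / J with ha
    -- The centred increment f (x j) - a has mean zero over j, so the cross term with `A` cancels
    -- and the average square grows by at most that of f.
    have hpt : ∀ v, ∑ j ∈ Finset.range J, (A v + f (x j) v - a v) ^ 2 ≤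
        ∑ j ∈ Finset.range J, (A v ^ 2 + f (x j) v ^ 2) := by
      intro v
      have h1 : ∑ j ∈ Finset.range J, f (x j) v = J * a v := by
        simp only [ha]; field_simp
      have h2 : ∑ j ∈ Finset.range J, (A v + f (x j) v - a v) ^ 2 =
          ∑ j ∈ Finset.range J, (A v ^ 2 + f (x j) v ^ 2) +
            (J * (a v ^ 2 - 2 * A v * a v) +
              (2 * A v - 2 * a v) * ∑ j ∈ Finset.range J, f (x j) v) := by
        rw [Finset.mul_sum, ← Finset.card_range J, ← nsmul_eq_mul, ← Finset.sum_const,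
          Finset.card_range, ← Finset.sum_add_distrib, ← Finset.sum_add_distrib]
        exact Finset.sum_congr rfl fun j _ => by ring
      rw [h2, h1]
      nlinarith [mul_nonneg hJ'.le (sq_nonneg (a v))]
    have hsum : ∑ j ∈ Finset.range J, ∑ v ∈ G, (A v + f (x j) v - a v) ^ 2 ≤
        ∑ j ∈ Finset.range J, ((m + 1 : ℕ) : ℝ) * c := by
      calc _ = ∑ v ∈ G, ∑ j ∈ Finset.range J, (A v + f (x j) v - a v) ^ 2 := Finset.sum_comm
        _ ≤ ∑ v ∈ G, ∑ j ∈ Finset.range J, (A v ^ 2 + f (x j) v ^ 2) :=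
            Finset.sum_le_sum fun v _ => hpt v
        _ = ∑ j ∈ Finset.range J, ∑ v ∈ G, (A v ^ 2 + f (x j) v ^ 2) := Finset.sum_comm
        _ ≤ _ := by
            refine Finset.sum_le_sum fun j _ => ?_
            rw [Finset.sum_add_distrib]
            push_cast
            linarith [hc (x j)]
    obtain ⟨j, -, hj⟩ := Finset.exists_le_of_sum_le (Finset.nonempty_range_iff.2 hJ.ne') hsum
    refine ⟨Sym.cons (x j) σ, le_trans (le_of_eq (Finset.sum_congr rfl fun v _ => ?_)) hj⟩
    simp only [Sym.coe_cons, Multiset.map_cons, Multiset.sum_cons, hA, ha]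
    push_cast
    congr 1
    ring

/-! ### The avoidance martingales and their concentration. -/

section Martingale

open Classical

variable {V : Type*} [Fintype V] {p : Matrix V V ℝ}

/-- Up to block `j`, the blocks of length `L` after time `o` have given `v` chances of being hit
that are individually at most `1 / 2` and add up to at most `S v + 1`. -/
def IsActive (p : Matrix V V ℝ) (L o : ℕ) (S : V → ℝ) (ω : ℕ → V) (v : V) (j : ℕ) : Prop :=
  (∀ i ≤ j, hitProb p L (ω (o + i * L)) v ≤ 1 / 2) ∧
    ∑ i ∈ Finset.range (j + 1), hitProb p L (ω (o + i * L)) v ≤ S v + 1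

/-- The vertex `v` is hit in block `j`. -/
def HitBlock (L o : ℕ) (ω : ℕ → V) (v : V) (j : ℕ) : Prop :=
  ∃ t, 1 ≤ t ∧ t ≤ L ∧ ω (o + j * L + t) = v

/-- The factor contributed by block `j` to the martingale attached to `v`. -/
noncomputable def blockFactor (p : Matrix V V ℝ) (L o : ℕ) (S : V → ℝ) (ω : ℕ → V) (v : V)
    (j : ℕ) : ℝ :=
  if IsActive p L o S ω v j then
    (if HitBlock L o ω v j then 0 else (1 - hitProb p L (ω (o + j * L)) v)⁻¹) else 1

/-- The indicator that `v` is not hit, divided by the product of the conditional probabilities of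
not being hit, frozen as soon as `v` is no longer active. -/
noncomputable def avoidMartingale (p : Matrix V V ℝ) (L o : ℕ) (S : V → ℝ) (ω : ℕ → V) (v : V)
    (j : ℕ) : ℝ :=
  ∏ i ∈ Finset.range j, blockFactor p L o S ω v i

theorem isActive_congr {L o j : ℕ} {S : V → ℝ} {ω ω' : ℕ → V}
    (h : ∀ t ≤ o + j * L, ω t = ω' t) (v : V) :
    IsActive p L o S ω v j ↔ IsActive p L o S ω' v j := by
  have h' : ∀ i ≤ j, ω (o + i * L) = ω' (o + i * L) := fun i hi =>
    h _ (Nat.add_le_add_left (Nat.mul_le_mul_right L hi) o)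
  unfold IsActive
  rw [Finset.sum_congr rfl fun i hi => by
    rw [h' i (Nat.lt_succ_iff.1 (Finset.mem_range.1 hi))]]
  refine and_congr_left fun _ => forall_congr' fun i => forall_congr' fun hi => ?_
  rw [h' i hi]

theorem blockFactor_congr {L o j : ℕ} {S : V → ℝ} {ω ω' : ℕ → V}
    (h : ∀ t ≤ o + j * L + L, ω t = ω' t) (v : V) :
    blockFactor p L o S ω v j = blockFactor p L o S ω' v j := by
  have h1 := isActive_congr (p := p) (S := S) (L := L) (o := o) (j := j) (ω := ω) (ω' := ω')
    (fun t ht => h t (by omega)) v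
  have h2 : HitBlock L o ω v j ↔ HitBlock L o ω' v j := by
    refine exists_congr fun t => and_congr_right fun _ => and_congr_right fun ht => ?_
    rw [h _ (by omega)]
  unfold blockFactor
  rw [if_congr h1 rfl rfl, if_congr h2 rfl rfl, h _ (by omega)]

theorem avoidMartingale_congr {L o j : ℕ} {S : V → ℝ} {ω ω' : ℕ → V}
    (h : ∀ t ≤ o + j * L, ω t = ω' t) (v : V) :
    avoidMartingale p L o S ω v j = avoidMartingale p L o S ω' v j := by
  refine Finset.prod_congr rfl fun i hi => blockFactor_congr (fun t ht => h t (ht.trans ?_)) v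
  have := Nat.mul_le_mul_right L (Finset.mem_range.1 hi)
  rw [Nat.succ_mul] at this
  omega

theorem inv_one_sub_le_exp {h : ℝ} (h0 : 0 ≤ h) (h1 : h ≤ 1 / 2) :
    (1 - h)⁻¹ ≤ Real.exp (2 * h) := by
  have h2 : (1 - h)⁻¹ ≤ 2 * h + 1 := by
    rw [inv_le_iff_one_le_mul₀ (by linarith)]
    nlinarith
  exact h2.trans (Real.add_one_le_exp _)

theorem blockFactor_nonneg (p : Matrix V V ℝ) (L o : ℕ) (S : V → ℝ)
    (ω : ℕ → V) (v : V) (j : ℕ) : 0 ≤ blockFactor p L o S ω v j := by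
  unfold blockFactor
  split_ifs with h1 h2
  · exact le_rfl
  · exact inv_nonneg.2 (by linarith [h1.1 j le_rfl])
  · norm_num

theorem avoidMartingale_nonneg (p : Matrix V V ℝ) (L o : ℕ) (S : V → ℝ)
    (ω : ℕ → V) (v : V) (j : ℕ) : 0 ≤ avoidMartingale p L o S ω v j :=
  Finset.prod_nonneg fun _ _ => blockFactor_nonneg p _ _ _ _ _ _

variable [DecidableEq V]

theorem blockFactor_le (hp : p ∈ Matrix.rowStochastic ℝ V) (L o : ℕ) (S : V → ℝ)
    (ω : ℕ → V) (v : V) (j : ℕ) : blockFactor p L o S ω v j ≤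
      Real.exp (2 * if IsActive p L o S ω v j then hitProb p L (ω (o + j * L)) v else 0) := by
  unfold blockFactor
  split_ifs with h1 h2
  · exact (Real.exp_pos _).le
  · exact inv_one_sub_le_exp (hitProb_nonneg hp _ _ _) (h1.1 j le_rfl)
  · simp

/-- Each active factor is at most e^(2h) because h ≤ 1/2. Activity of block j already counts the
chance of block j, which is known when the block starts, so the chances of the active blocks never
add up to more than S v + 1. -/
theorem avoidMartingale_le (hp : p ∈ Matrix.rowStochastic ℝ V) (L o : ℕ) {S : V → ℝ}
    (ω : ℕ → V) {v : V} (hS : 0 ≤ S v) (j : ℕ) :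
    avoidMartingale p L o S ω v j ≤ Real.exp (2 * (S v + 1)) := by
  have h1 : avoidMartingale p L o S ω v j ≤ Real.exp (2 * ∑ i ∈ Finset.range j,
      if IsActive p L o S ω v i then hitProb p L (ω (o + i * L)) v else 0) := by
    rw [Finset.mul_sum, Real.exp_sum]
    exact Finset.prod_le_prod (fun _ _ => blockFactor_nonneg p _ _ _ _ _ _)
      fun _ _ => blockFactor_le hp _ _ _ _ _ _
  refine h1.trans (Real.exp_le_exp.2 (mul_le_mul_of_nonneg_left ?_ (by norm_num)))
  clear h1
  induction j with
  | zero => simp; linarith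
  | succ j ih =>
    by_cases hj : IsActive p L o S ω v j
    · refine le_trans (Finset.sum_le_sum fun i _ => ?_) hj.2
      split_ifs
      · exact le_rfl
      · exact hitProb_nonneg hp _ _ _
    · rw [Finset.sum_range_succ, if_neg hj, add_zero]
      exact ih

/-- The exponential moment of one increment of the sum of the martingales. -/
theorem pathExp_exp_increment_le (hp : p ∈ Matrix.rowStochastic ℝ V) {L o : ℕ} {S : V → ℝ}
    {G : Finset V} {C lam : ℝ} (hS : ∀ v ∈ G, 0 ≤ S v)
    (hC : ∀ v ∈ G, Real.exp (2 * (S v + 1)) ≤ C) (hC0 : 0 ≤ C) (hlam : 0 ≤ lam)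
    (hlam1 : lam * (3 * C * L) ≤ 1) (j : ℕ) (ω : ℕ → V) :
    pathExp p L (ω (o + j * L)) (fun ω' => Real.exp (-lam *
      (∑ v ∈ G, avoidMartingale p L o S (pathGlue (o + j * L) ω ω') v (j + 1) -
        ∑ v ∈ G, avoidMartingale p L o S (pathGlue (o + j * L) ω ω') v j))) ≤
      Real.exp ((lam * (3 * C * L)) ^ 2) := by
  set y := ω (o + j * L) with hy
  set μ : V → ℝ := fun v => avoidMartingale p L o S ω v j with hμ
  set φ : V → (ℕ → V) → ℝ := fun v ω' => if IsActive p L o S ω v j then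
    (if ∃ t, 1 ≤ t ∧ t ≤ L ∧ ω' t = v then 0 else (1 - hitProb p L y v)⁻¹) else 1 with hφ
  set Δ : (ℕ → V) → ℝ := fun ω' => ∑ v ∈ G, μ v * (φ v ω' - 1) with hΔ
  set c := 3 * C * L with hc
  have hc0 : 0 ≤ c := by positivity
  have hL0 : (0 : ℝ) ≤ L := Nat.cast_nonneg L
  have heq : ∀ ω' : ℕ → V, ω' 0 = y →
      ∑ v ∈ G, avoidMartingale p L o S (pathGlue (o + j * L) ω ω') v (j + 1) -
        ∑ v ∈ G, avoidMartingale p L o S (pathGlue (o + j * L) ω ω') v j = Δ ω' := by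
    intro ω' hω'
    rw [← Finset.sum_sub_distrib]
    refine Finset.sum_congr rfl fun v _ => ?_
    have h1 : avoidMartingale p L o S (pathGlue (o + j * L) ω ω') v j = μ v :=
      avoidMartingale_congr (fun t ht => pathGlue_of_le ht _ _) v
    have h2 : blockFactor p L o S (pathGlue (o + j * L) ω ω') v j = φ v ω' := by
      have h3 := isActive_congr (p := p) (S := S) (L := L) (o := o) (j := j)
        (ω := pathGlue (o + j * L) ω ω') (ω' := ω) (fun t ht => pathGlue_of_le ht _ _) v
      have h4 : HitBlock L o (pathGlue (o + j * L) ω ω') v j ↔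
          ∃ t, 1 ≤ t ∧ t ≤ L ∧ ω' t = v := by
        unfold HitBlock
        simp only [pathGlue_add hω']
      unfold blockFactor
      rw [if_congr h3 rfl rfl, if_congr h4 rfl rfl, pathGlue_of_le le_rfl]
    have h5 : avoidMartingale p L o S (pathGlue (o + j * L) ω ω') v (j + 1) = μ v * φ v ω' := by
      rw [← h1, ← h2]
      exact Finset.prod_range_succ _ _
    rw [h5, h1]
    ring
  -- Martingale property: an active factor is 1/(1 - h) with conditional probability 1 - h and 0
  -- otherwise.
  have hmean : pathExp p L y Δ = 0 := by
    simp only [hΔ]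
    rw [pathExp_sum]
    refine Finset.sum_eq_zero fun v _ => ?_
    rw [pathExp_mul_left]
    have : pathExp p L y (fun ω' => φ v ω' - 1) = 0 := by
      by_cases ha : IsActive p L o S ω v j
      · have hlt : 0 < 1 - hitProb p L y v := by linarith [ha.1 j le_rfl]
        have h1 : pathExp p L y (fun ω' => φ v ω' - 1) = pathExp p L y (fun ω' =>
            ((1 - hitProb p L y v)⁻¹ - 1) - (1 - hitProb p L y v)⁻¹ *
              (if ∃ t, 1 ≤ t ∧ t ≤ L ∧ ω' t = v then 1 else 0)) := by
          refine pathExp_congr _ _ fun ω' _ => ?_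
          simp only [hφ, if_pos ha]
          split_ifs <;> ring
        rw [h1, pathExp_sub, pathExp_const hp, pathExp_mul_left]
        change _ - _ * hitProb p L y v = 0
        field_simp
        ring
      · simp only [hφ, if_neg ha, sub_self]
        exact pathExp_zero_fun _ _
    rw [this, mul_zero]
  -- A block visits at most L vertices, and the hitting chances also sum to at most L. Since 1/(1 -
  -- h) - 1 ≤ 2h, the increment is at most C(L + 2L), however large `G` is.
  have hbound : ∀ ω', |Δ ω'| ≤ c := by
    intro ω'
    calc |Δ ω'| ≤ ∑ v ∈ G, |μ v * (φ v ω' - 1)| := Finset.abs_sum_le_sum_abs _ _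
      _ ≤ ∑ v ∈ G, C * ((if ∃ t, 1 ≤ t ∧ t ≤ L ∧ ω' t = v then 1 else 0) +
            2 * hitProb p L y v) := by
          refine Finset.sum_le_sum fun v hv => ?_
          have hh := hitProb_nonneg hp L y v
          rw [abs_mul, abs_of_nonneg (avoidMartingale_nonneg p _ _ _ _ _ _)]
          refine mul_le_mul ((avoidMartingale_le hp _ _ _ (hS v hv) _).trans (hC v hv)) ?_
            (abs_nonneg _) hC0
          simp only [hφ]
          split_ifs with h1 h2
          · norm_num
            exact hh
          · have h3 := h1.1 j le_rfl
            have h4 : 0 < 1 - hitProb p L y v := by linarith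
            have h5 : (1 - hitProb p L y v)⁻¹ - 1 =
                hitProb p L y v / (1 - hitProb p L y v) := by field_simp; ring
            rw [h5, abs_of_nonneg (div_nonneg hh h4.le), zero_add, div_le_iff₀ h4]
            nlinarith
          · norm_num
            linarith
          · norm_num
            exact hh
      _ = C * ((∑ v ∈ G, if ∃ t, 1 ≤ t ∧ t ≤ L ∧ ω' t = v then 1 else 0) +
            2 * ∑ v ∈ G, hitProb p L y v) := by
          rw [← Finset.mul_sum, Finset.sum_add_distrib, Finset.mul_sum]
      _ ≤ C * (L + 2 * L) := by
          refine mul_le_mul_of_nonneg_left ?_ hC0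
          have h1 : (∑ v ∈ G, if ∃ t, 1 ≤ t ∧ t ≤ L ∧ ω' t = v then (1 : ℝ) else 0) ≤ L := by
            rw [Finset.sum_boole]
            exact_mod_cast card_filter_exists_le G L ω'
          linarith [sum_hitProb_le hp L y G]
      _ = c := by rw [hc]; ring
  calc _ ≤ pathExp p L y (fun ω' => (1 + (lam * c) ^ 2) - lam * Δ ω') := by
        refine pathExp_mono hp _ _ fun ω' hω' => ?_
        rw [heq ω' hω']
        have h1 : |-lam * Δ ω'| ≤ lam * c := by
          rw [abs_mul, abs_neg, abs_of_nonneg hlam]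
          exact mul_le_mul_of_nonneg_left (hbound ω') hlam
        have h2 := (abs_le.1 (Real.abs_exp_sub_one_sub_id_le (h1.trans hlam1))).2
        have h3 : (-lam * Δ ω') ^ 2 ≤ (lam * c) ^ 2 := sq_le_sq' (abs_le.1 h1).1 (abs_le.1 h1).2
        linarith
    _ = 1 + (lam * c) ^ 2 := by
        rw [pathExp_sub, pathExp_const hp, pathExp_mul_left, hmean]; ring
    _ ≤ Real.exp ((lam * c) ^ 2) := by linarith [Real.add_one_le_exp ((lam * c) ^ 2)]

/-- Chernoff's bound: the increments telescope from the initial value |G|, and each block multiplies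
the exponential moment by at most exp((3λCL)²). -/
theorem pathExp_avoidMartingale_tail (hp : p ∈ Matrix.rowStochastic ℝ V) {L o J T : ℕ} {S : V → ℝ}
    {G : Finset V} {C lam a : ℝ} (hT : o + J * L ≤ T) (hS : ∀ v ∈ G, 0 ≤ S v)
    (hC : ∀ v ∈ G, Real.exp (2 * (S v + 1)) ≤ C) (hC0 : 0 ≤ C) (hlam : 0 ≤ lam)
    (hlam1 : lam * (3 * C * L) ≤ 1) (x : V) :
    pathExp p T x (fun ω => if ∑ v ∈ G, avoidMartingale p L o S ω v J ≤ G.card - a then 1 else 0) ≤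
      Real.exp (-lam * a + J * (lam * (3 * C * L)) ^ 2) := by
  set g : ℕ → (ℕ → V) → ℝ := fun j ω => Real.exp (-lam *
    (∑ v ∈ G, avoidMartingale p L o S ω v (j + 1) -
      ∑ v ∈ G, avoidMartingale p L o S ω v j)) with hg
  have hdep : ∀ j, DependsOn (g j) (Set.Iic (o + j * L + L)) := by
    intro j ω ω' h
    have h1 : ∀ v, avoidMartingale p L o S ω v (j + 1) = avoidMartingale p L o S ω' v (j + 1) :=
      avoidMartingale_congr fun t ht => h t (by
        rw [Nat.succ_mul] at ht
        exact Set.mem_Iic.2 (by omega))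
    have h2 : ∀ v, avoidMartingale p L o S ω v j = avoidMartingale p L o S ω' v j :=
      avoidMartingale_congr fun t ht => h t (Set.mem_Iic.2 (by omega))
    simp only [hg, h1, h2]
  have hprod := pathExp_prod_le hp (g := g) (c := Real.exp ((lam * (3 * C * L)) ^ 2)) o L J
    (fun _ _ _ => (Real.exp_pos _).le) (fun j _ => hdep j)
    (fun j _ ω => pathExp_exp_increment_le hp hS hC hC0 hlam hlam1 j ω) x
  have htel : ∀ ω, ∏ j ∈ Finset.range J, g j ω = Real.exp (-lam *
      (∑ v ∈ G, avoidMartingale p L o S ω v J - G.card)) := by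
    intro ω
    simp only [hg]
    rw [← Real.exp_sum, ← Finset.mul_sum,
      Finset.sum_range_sub (fun j => ∑ v ∈ G, avoidMartingale p L o S ω v j)]
    simp [avoidMartingale]
  have hdepJ : DependsOn (fun ω => if ∑ v ∈ G, avoidMartingale p L o S ω v J ≤ G.card - a
      then (1 : ℝ) else 0) (Set.Iic (o + J * L)) := by
    intro ω ω' h
    have : ∀ v, avoidMartingale p L o S ω v J = avoidMartingale p L o S ω' v J :=
      avoidMartingale_congr fun t ht => h t (Set.mem_Iic.2 ht)
    simp only [this]
  rw [pathExp_of_dependsOn hp hdepJ hT]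
  calc _ ≤ pathExp p (o + J * L) x (fun ω => Real.exp (-lam * a) *
          ∏ j ∈ Finset.range J, g j ω) := by
        refine pathExp_mono hp _ _ fun ω _ => ?_
        rw [htel, ← Real.exp_add]
        split_ifs with h
        · refine Real.one_le_exp ?_
          nlinarith
        · exact (Real.exp_pos _).le
    _ ≤ Real.exp (-lam * a) * Real.exp ((lam * (3 * C * L)) ^ 2) ^ J := by
        rw [pathExp_mul_left]
        exact mul_le_mul_of_nonneg_left hprod (Real.exp_pos _).le
    _ = _ := by rw [← Real.exp_nat_mul, ← Real.exp_add]

end Martingale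

/-! ### Covering is unlikely when the near mass is small. -/

section Transient

open Classical

variable {V : Type*} [Fintype V] [DecidableEq V] {p : Matrix V V ℝ}

/-- The hitting probability, with the values above `δ` replaced by zero. -/
noncomputable def farHitProb (p : Matrix V V ℝ) (L : ℕ) (δ : ℝ) (x v : V) : ℝ :=
  if δ < hitProb p L x v then 0 else hitProb p L x v

theorem farHitProb_nonneg (hp : p ∈ Matrix.rowStochastic ℝ V) (L : ℕ) (δ : ℝ) (x v : V) :
    0 ≤ farHitProb p L δ x v := by
  unfold farHitProb
  split_ifs
  · exact le_rfl
  · exact hitProb_nonneg hp L x v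

theorem sum_farHitProb_le (hp : p ∈ Matrix.rowStochastic ℝ V) (L : ℕ) (δ : ℝ) (G : Finset V)
    (x : V) : ∑ v ∈ G, farHitProb p L δ x v ≤ L := by
  refine le_trans (Finset.sum_le_sum fun v _ => ?_) (sum_hitProb_le hp L x G)
  unfold farHitProb
  split_ifs
  · exact hitProb_nonneg hp L x v
  · exact le_rfl

/-- The cutoff at δ is made for this bound, which is the variance in the sampling step. -/
theorem sum_farHitProb_sq_le (hp : p ∈ Matrix.rowStochastic ℝ V) (L : ℕ) {δ : ℝ} (hδ : 0 ≤ δ)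
    (G : Finset V) (x : V) : ∑ v ∈ G, farHitProb p L δ x v ^ 2 ≤ δ * L := by
  calc ∑ v ∈ G, farHitProb p L δ x v ^ 2 ≤ ∑ v ∈ G, δ * farHitProb p L δ x v := by
        refine Finset.sum_le_sum fun v _ => ?_
        rw [sq]
        refine mul_le_mul_of_nonneg_right ?_ (farHitProb_nonneg hp L δ x v)
        unfold farHitProb
        split_ifs with h
        · exact hδ
        · exact not_lt.1 h
    _ ≤ δ * L := by
        rw [← Finset.mul_sum]
        exact mul_le_mul_of_nonneg_left (sum_farHitProb_le hp L δ G x) hδ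

/-- The accumulated far hitting probabilities, estimated from a sample of block starts. -/
noncomputable def sampledChance (p : Matrix V V ℝ) (L : ℕ) (δ : ℝ) (J : ℕ) {m : ℕ} (σ : Sym V m)
    (v : V) : ℝ :=
  J / m * ((σ : Multiset V).map fun y => farHitProb p L δ y v).sum

theorem sampledChance_nonneg (hp : p ∈ Matrix.rowStochastic ℝ V) (L : ℕ) (δ : ℝ) (J : ℕ) {m : ℕ}
    (σ : Sym V m) (v : V) : 0 ≤ sampledChance p L δ J σ v := by
  refine mul_nonneg (by positivity) (Multiset.sum_nonneg fun a ha => ?_)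
  obtain ⟨y, -, rfl⟩ := Multiset.mem_map.1 ha
  exact farHitProb_nonneg hp L δ y v

theorem sum_sampledChance_le (hp : p ∈ Matrix.rowStochastic ℝ V) (L : ℕ) (δ : ℝ) (J : ℕ) {m : ℕ}
    (hm : 0 < m) (σ : Sym V m) (G : Finset V) :
    ∑ v ∈ G, sampledChance p L δ J σ v ≤ J * L := by
  have hm' : (0 : ℝ) < m := by exact_mod_cast hm
  unfold sampledChance
  rw [← Finset.mul_sum]
  have h1 : ∑ v ∈ G, ((σ : Multiset V).map fun y => farHitProb p L δ y v).sum =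
      ((σ : Multiset V).map fun y => ∑ v ∈ G, farHitProb p L δ y v).sum :=
    Multiset.sum_map_sum_map _ _ |>.trans rfl
  have h2 : ((σ : Multiset V).map fun y => ∑ v ∈ G, farHitProb p L δ y v).sum ≤ m * L := by
    have := Multiset.sum_le_card_nsmul ((σ : Multiset V).map fun y =>
      ∑ v ∈ G, farHitProb p L δ y v) (L : ℝ) (by
        intro a ha
        obtain ⟨y, -, rfl⟩ := Multiset.mem_map.1 ha
        exact sum_farHitProb_le hp L δ G y)
    rw [Multiset.card_map, nsmul_eq_mul] at this
    have hcard : (σ : Multiset V).card = m := σ.2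
    rwa [hcard] at this
  rw [h1]
  calc (J : ℝ) / m * _ ≤ J / m * (m * L) := mul_le_mul_of_nonneg_left h2 (by positivity)
    _ = J * L := by field_simp

theorem exists_sampledChance_sq_le (hp : p ∈ Matrix.rowStochastic ℝ V) (L : ℕ) {δ : ℝ}
    (hδ : 0 ≤ δ) {J m : ℕ} (hJ : 0 < J) (hm : 0 < m) (G : Finset V) (x : ℕ → V) :
    ∃ σ : Sym V m, ∑ v ∈ G, (sampledChance p L δ J σ v -
      ∑ j ∈ Finset.range J, farHitProb p L δ (x j) v) ^ 2 ≤ (J : ℝ) ^ 2 * δ * L / m := by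
  have hm' : (0 : ℝ) < m := by exact_mod_cast hm
  have hJ' : (0 : ℝ) < J := by exact_mod_cast hJ
  obtain ⟨σ, hσ⟩ := exists_sym_sum_sq_le x (farHitProb p L δ) G hJ
    (sum_farHitProb_sq_le hp L hδ G) m
  refine ⟨σ, ?_⟩
  have h1 : ∑ v ∈ G, (sampledChance p L δ J σ v -
      ∑ j ∈ Finset.range J, farHitProb p L δ (x j) v) ^ 2 =
      ((J : ℝ) / m) ^ 2 * ∑ v ∈ G, (((σ : Multiset V).map fun y => farHitProb p L δ y v).sum -
      m / J * ∑ j ∈ Finset.range J, farHitProb p L δ (x j) v) ^ 2 := by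
    rw [Finset.mul_sum]
    refine Finset.sum_congr rfl fun v _ => ?_
    unfold sampledChance
    rw [← mul_pow, mul_sub]
    congr 2
    field_simp
  rw [h1]
  calc _ ≤ ((J : ℝ) / m) ^ 2 * (m * (δ * L)) := mul_le_mul_of_nonneg_left hσ (by positivity)
    _ = _ := by field_simp

/-- Chebyshev's inequality for counting. -/
theorem card_filter_lt_mul_le {ι : Type*} (G : Finset ι) (f : ι → ℝ) (hf : ∀ v ∈ G, 0 ≤ f v)
    {c Y : ℝ} (hY : ∑ v ∈ G, f v ≤ Y) : ((G.filter fun v => c < f v).card : ℝ) * c ≤ Y := by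
  calc ((G.filter fun v => c < f v).card : ℝ) * c = ∑ v ∈ G.filter (fun v => c < f v), c := by
        rw [Finset.sum_const, nsmul_eq_mul]
    _ ≤ ∑ v ∈ G.filter (fun v => c < f v), f v :=
        Finset.sum_le_sum fun v hv => (Finset.mem_filter.1 hv).2.le
    _ ≤ ∑ v ∈ G, f v := Finset.sum_le_sum_of_subset_of_nonneg (Finset.filter_subset _ _)
        fun v hv _ => hf v hv
    _ ≤ Y := hY

/-- A covered vertex missed by all blocks is seen at one of the T - JL times in [1, T] outside the
blocks. -/
theorem Covers.card_not_hitBlock_le {V : Type*} [DecidableEq V] {G : Finset V} {T L o J : ℕ}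
    {ω : ℕ → V} (h : Covers G T ω) (hT : o + J * L ≤ T) :
    (G.filter fun v => ∀ j < J, ¬ HitBlock L o ω v j).card + J * L ≤ T := by
  have hsub : (G.filter fun v => ∀ j < J, ¬ HitBlock L o ω v j) ⊆
      ((Finset.Icc 1 T) \ (Finset.Ioc o (o + J * L))).image ω := by
    intro v hv
    obtain ⟨hvG, hv'⟩ := Finset.mem_filter.1 hv
    obtain ⟨t, h1, h2, h3⟩ := h v hvG
    refine Finset.mem_image.2 ⟨t, Finset.mem_sdiff.2 ⟨Finset.mem_Icc.2 ⟨h1, h2⟩, fun ht => ?_⟩, h3⟩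
    obtain ⟨h4, h5⟩ := Finset.mem_Ioc.1 ht
    have hL : 0 < L := by
      rcases Nat.eq_zero_or_pos L with h | h
      · subst h; omega
      · exact h
    have hdm := Nat.div_add_mod (t - o - 1) L
    have hmod := Nat.mod_lt (t - o - 1) hL
    have hj : (t - o - 1) / L < J := Nat.div_lt_of_lt_mul (by rw [mul_comm]; omega)
    refine hv' _ hj ⟨(t - o - 1) % L + 1, by omega, by omega, ?_⟩
    rw [mul_comm _ L, show o + L * ((t - o - 1) / L) + ((t - o - 1) % L + 1) = t by omega, h3]
  have h1 := (Finset.card_le_card hsub).trans Finset.card_image_le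
  rw [Finset.card_sdiff_of_subset, Nat.card_Icc, Nat.card_Ioc] at h1
  · omega
  · intro t ht
    rw [Finset.mem_Ioc] at ht
    exact Finset.mem_Icc.2 ⟨by omega, by omega⟩

theorem avoidMartingale_eq_zero {V : Type*} [Fintype V] {p : Matrix V V ℝ} {L o J : ℕ}
    {S : V → ℝ} {ω : ℕ → V} {v : V}
    (hact : ∀ j < J, IsActive p L o S ω v j) (hhit : ∃ j < J, HitBlock L o ω v j) :
    avoidMartingale p L o S ω v J = 0 := by
  obtain ⟨j, hj, hh⟩ := hhit
  refine Finset.prod_eq_zero (Finset.mem_range.2 hj) ?_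
  unfold blockFactor
  rw [if_pos (hact j hj), if_pos hh]

/-- A single chance above 1/2 would exceed δ and hence count in the near sum. The total splits into
a near part of at most 1/2 and a far part within 1/2 of `S v`, which is why activity allows a slack
of 1. -/
theorem isActive_of_le (hp : p ∈ Matrix.rowStochastic ℝ V) {L o J : ℕ} {δ : ℝ} (hδ : δ ≤ 1 / 2)
    {S : V → ℝ} {ω : ℕ → V} {v : V}
    (hnear : ∑ j ∈ Finset.range J, (if δ < hitProb p L (ω (o + j * L)) v then
      hitProb p L (ω (o + j * L)) v else 0) ≤ 1 / 2)
    (hfar : ∑ j ∈ Finset.range J, farHitProb p L δ (ω (o + j * L)) v ≤ S v + 1 / 2)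
    {j : ℕ} (hj : j < J) : IsActive p L o S ω v j := by
  have hnn : ∀ i, 0 ≤ (if δ < hitProb p L (ω (o + i * L)) v then
      hitProb p L (ω (o + i * L)) v else 0) := fun i => by
    split_ifs
    · exact hitProb_nonneg hp _ _ _
    · exact le_rfl
  refine ⟨fun i hi => ?_, ?_⟩
  · by_contra hlt
    push Not at hlt
    have h1 := Finset.single_le_sum (f := fun i => if δ < hitProb p L (ω (o + i * L)) v then
      hitProb p L (ω (o + i * L)) v else 0) (fun i _ => hnn i)
      (Finset.mem_range.2 (by omega : i < J))
    rw [if_pos (by linarith)] at h1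
    linarith
  · calc ∑ i ∈ Finset.range (j + 1), hitProb p L (ω (o + i * L)) v
        ≤ ∑ i ∈ Finset.range J, hitProb p L (ω (o + i * L)) v :=
          Finset.sum_le_sum_of_subset_of_nonneg (Finset.range_subset_range.2 hj)
            fun _ _ _ => hitProb_nonneg hp _ _ _
      _ = ∑ i ∈ Finset.range J, (if δ < hitProb p L (ω (o + i * L)) v then
            hitProb p L (ω (o + i * L)) v else 0) +
          ∑ i ∈ Finset.range J, farHitProb p L δ (ω (o + i * L)) v := by
          rw [← Finset.sum_add_distrib]
          refine Finset.sum_congr rfl fun i _ => ?_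
          unfold farHitProb
          split_ifs <;> simp
      _ ≤ S v + 1 := by linarith

/-- On a covering path with small near mass, the sum of the martingales ends far below its initial
value. -/
theorem Covers.sum_avoidMartingale_le (hp : p ∈ Matrix.rowStochastic ℝ V) {G : Finset V}
    {T L o J m : ℕ} {ω : ℕ → V} (h : Covers G T ω) (hT : o + J * L ≤ T) (hTL : T ≤ J * L + 3 * L)
    {δ Y S' : ℝ} (hδ : δ ≤ 1 / 2) (hm : 0 < m)
    (hY : ∑ j ∈ Finset.range J, nearMass p L δ G (ω (o + j * L)) ≤ Y) (hS' : 0 < S')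
    {σ : Sym V m} {E a : ℝ} (hσ : ∑ v ∈ G, (sampledChance p L δ J σ v -
      ∑ j ∈ Finset.range J, farHitProb p L δ (ω (o + j * L)) v) ^ 2 ≤ E)
    (ha : a + Real.exp (2 * (S' + 1)) * (3 * L + 2 * Y + 4 * E) ≤ G.card - J * L / S') :
    ∑ v ∈ G.filter (fun v => sampledChance p L δ J σ v ≤ S'),
        avoidMartingale p L o (sampledChance p L δ J σ) ω v J ≤
      (G.filter (fun v => sampledChance p L δ J σ v ≤ S')).card - a := by
  set S := sampledChance p L δ J σ with hS
  set C := Real.exp (2 * (S' + 1)) with hC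
  set near : V → ℝ := fun v => ∑ j ∈ Finset.range J,
    (if δ < hitProb p L (ω (o + j * L)) v then hitProb p L (ω (o + j * L)) v else 0) with hnear
  set far : V → ℝ := fun v => ∑ j ∈ Finset.range J, farHitProb p L δ (ω (o + j * L)) v with hfar
  have hS0 : ∀ v, 0 ≤ S v := sampledChance_nonneg hp L δ J σ
  -- The exceptional vertices: missed by the blocks (at most 3L), of near chance above 1/2 (at most
  -- 2Y), of sampled chance off by more than 1/2 (at most 4E). All others with S v ≤ S' stay active
  -- and are hit, so their martingale ends at 0, while an exceptional one is at most C.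
  set U₁ := G.filter fun v => ∀ j < J, ¬ HitBlock L o ω v j with hU₁
  set U₂ := G.filter fun v => 1 / 2 < near v with hU₂
  set U₃ := G.filter fun v => 1 / 4 < (S v - far v) ^ 2 with hU₃
  have hc₁ : (U₁.card : ℝ) ≤ 3 * L := by
    have h1 : U₁.card + J * L ≤ T := h.card_not_hitBlock_le hT
    have h2 : U₁.card ≤ 3 * L := by omega
    exact_mod_cast h2
  have hc₂ : (U₂.card : ℝ) * (1 / 2) ≤ Y := by
    refine card_filter_lt_mul_le G near (fun v _ => Finset.sum_nonneg fun j _ => ?_) ?_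
    · split_ifs
      · exact hitProb_nonneg hp _ _ _
      · exact le_rfl
    · rw [Finset.sum_comm]
      exact hY
  have hc₃ : (U₃.card : ℝ) * (1 / 4) ≤ E :=
    card_filter_lt_mul_le G (fun v => (S v - far v) ^ 2) (fun v _ => sq_nonneg _) hσ
  have hc₄ : ((G.filter fun v => S' < S v).card : ℝ) * S' ≤ J * L :=
    card_filter_lt_mul_le G S (fun v _ => hS0 v) (sum_sampledChance_le hp L δ J hm σ G)
  have hcompl : ((G.filter fun v => S v ≤ S').card : ℝ) + (G.filter fun v => S' < S v).card =
      G.card := by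
    have := Finset.card_filter_add_card_filter_not (s := G) (fun v => S v ≤ S')
    simp only [not_le] at this
    exact_mod_cast this
  have hzero : ∀ v ∈ G.filter (fun v => S v ≤ S'), v ∉ U₁ ∪ U₂ ∪ U₃ →
      avoidMartingale p L o S ω v J = 0 := by
    intro v hv hU
    have hvG := (Finset.mem_filter.1 hv).1
    simp only [Finset.mem_union, not_or, hU₁, hU₂, hU₃, Finset.mem_filter, hvG, true_and,
      not_lt] at hU
    obtain ⟨⟨h1, h2⟩, h3⟩ := hU
    push Not at h1
    refine avoidMartingale_eq_zero (fun j hj => isActive_of_le hp hδ h2 ?_ hj) h1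
    have h4 : |S v - far v| ≤ 1 / 2 := by
      refine abs_le_of_sq_le_sq (by norm_num; linarith) (by norm_num)
    have := (abs_le.1 h4).1
    change far v ≤ _
    linarith
  calc ∑ v ∈ G.filter (fun v => S v ≤ S'), avoidMartingale p L o S ω v J
      ≤ ∑ v ∈ G.filter (fun v => S v ≤ S'), (if v ∈ U₁ ∪ U₂ ∪ U₃ then C else 0) := by
        refine Finset.sum_le_sum fun v hv => ?_
        split_ifs with hU
        · refine (avoidMartingale_le hp _ _ _ (hS0 v) _).trans (Real.exp_le_exp.2 ?_)
          linarith [(Finset.mem_filter.1 hv).2]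
        · exact (hzero v hv hU).le
    _ ≤ ∑ v ∈ U₁ ∪ U₂ ∪ U₃, C := by
        rw [← Finset.sum_filter]
        refine Finset.sum_le_sum_of_subset_of_nonneg ?_ fun _ _ _ => (Real.exp_pos _).le
        intro v hv
        exact (Finset.mem_filter.1 hv).2
    _ = (U₁ ∪ U₂ ∪ U₃).card * C := by rw [Finset.sum_const, nsmul_eq_mul]
    _ ≤ (3 * L + 2 * Y + 4 * E) * C := by
        refine mul_le_mul_of_nonneg_right ?_ (Real.exp_pos _).le
        have h1 : ((U₁ ∪ U₂ ∪ U₃).card : ℝ) ≤ U₁.card + U₂.card + U₃.card := by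
          exact_mod_cast (Finset.card_union_le _ _).trans
            (Nat.add_le_add_right (Finset.card_union_le _ _) _)
        linarith
    _ ≤ _ := by
        have h5 : ((G.filter fun v => S' < S v).card : ℝ) ≤ J * L / S' := by
          rwa [le_div_iff₀ hS']
        linarith

/-- The probability of covering `G` with small near mass. -/
theorem pathExp_covers_nearMass_le (hp : p ∈ Matrix.rowStochastic ℝ V) {G : Finset V}
    {T L o J m : ℕ} (hT : o + J * L ≤ T) (hTL : T ≤ J * L + 3 * L) (hJ : 0 < J) (hm : 0 < m)
    {δ Y S' a lam : ℝ} (hδ0 : 0 ≤ δ) (hδ : δ ≤ 1 / 2) (hS' : 0 < S')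
    (ha : a + Real.exp (2 * (S' + 1)) * (3 * L + 2 * Y + 4 * ((J : ℝ) ^ 2 * δ * L / m)) ≤
      G.card - J * L / S') (hlam : 0 ≤ lam)
    (hlam1 : lam * (3 * Real.exp (2 * (S' + 1)) * L) ≤ 1) (x : V) :
    pathExp p T x (fun ω => if Covers G T ω ∧
      ∑ j ∈ Finset.range J, nearMass p L δ G (ω (o + j * L)) ≤ Y then 1 else 0) ≤
    Fintype.card (Sym V m) *
      Real.exp (-lam * a + J * (lam * (3 * Real.exp (2 * (S' + 1)) * L)) ^ 2) := by
  set C := Real.exp (2 * (S' + 1)) with hC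
  -- The sample depends on the path, so the deterministic-profile estimate is summed over all
  -- multisets.
  calc _ ≤ pathExp p T x (fun ω => ∑ σ : Sym V m,
        if ∑ v ∈ G.filter (fun v => sampledChance p L δ J σ v ≤ S'),
          avoidMartingale p L o (sampledChance p L δ J σ) ω v J ≤
          (G.filter (fun v => sampledChance p L δ J σ v ≤ S')).card - a then 1 else 0) := by
        refine pathExp_mono hp _ _ fun ω _ => ?_
        have hnn : ∀ σ : Sym V m, 0 ≤
            (if ∑ v ∈ G.filter (fun v => sampledChance p L δ J σ v ≤ S'),
              avoidMartingale p L o (sampledChance p L δ J σ) ω v J ≤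
              (G.filter (fun v => sampledChance p L δ J σ v ≤ S')).card - a then (1 : ℝ) else 0) :=
          fun σ => by split_ifs <;> norm_num
        split_ifs with h
        · obtain ⟨σ, hσ⟩ := exists_sampledChance_sq_le hp L hδ0 hJ hm G
            (fun j => ω (o + j * L))
          refine le_trans ?_ (Finset.single_le_sum (fun σ _ => hnn σ) (Finset.mem_univ σ))
          rw [if_pos (h.1.sum_avoidMartingale_le hp hT hTL hδ hm h.2 hS' hσ ha)]
        · exact Finset.sum_nonneg fun σ _ => hnn σ
    _ ≤ ∑ σ : Sym V m, Real.exp (-lam * a + J * (lam * (3 * C * L)) ^ 2) := by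
        rw [pathExp_sum]
        refine Finset.sum_le_sum fun σ _ => ?_
        refine pathExp_avoidMartingale_tail hp hT
          (fun v _ => sampledChance_nonneg hp L δ J σ v) (fun v hv => Real.exp_le_exp.2 ?_)
          (Real.exp_pos _).le hlam hlam1 x
        linarith [(Finset.mem_filter.1 hv).2]
    _ = _ := by rw [Finset.sum_const, Finset.card_univ, nsmul_eq_mul]

end Transient

/-! ### Entropy of the samples and the choice of a scale. -/

theorem card_sym_le_exp {V : Type*} [Fintype V] {β : ℝ} (hβ : 0 < β) (hβ2 : β ≤ 1 / 2) {m : ℕ}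
    [Fintype (Sym V m)] (hm0 : (0 : ℝ) < m) (hm1 : β * Fintype.card V ≤ m)
    (hm2 : m ≤ 2 * β * Fintype.card V) :
    (Fintype.card (Sym V m) : ℝ) ≤
      Real.exp (2 * β * Fintype.card V * Real.log (2 * Real.exp 1 / β)) := by
  set n := Fintype.card V with hn
  have hn0 : (0 : ℝ) ≤ n := Nat.cast_nonneg n
  have hmn : m ≤ n := by
    have : (m : ℝ) ≤ n := by nlinarith
    exact_mod_cast this
  have he : 1 ≤ Real.exp 1 := Real.one_le_exp (by norm_num)
  have hbase : 1 ≤ 2 * Real.exp 1 / β := by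
    rw [le_div_iff₀ hβ]; linarith
  have hfac : (m : ℝ) ^ m / m.factorial ≤ Real.exp m := Real.pow_div_factorial_le_exp m hm0.le m
  have hfpos : (0 : ℝ) < m.factorial := by exact_mod_cast m.factorial_pos
  calc (Fintype.card (Sym V m) : ℝ) ≤ ((2 * n).choose m : ℕ) := by
        rw [Sym.card_sym_eq_choose]
        exact_mod_cast Nat.choose_le_choose m (by omega)
    _ ≤ ((2 * n : ℕ) : ℝ) ^ m / m.factorial := Nat.choose_le_pow_div _ _
    -- Here 2n ≤ 2m/β; a factor e^m is inserted and removed so that m^m / m! ≤ e^m can be used next.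
    _ ≤ (2 * Real.exp 1 / β * m) ^ m / m.factorial * (Real.exp m)⁻¹ := by
        rw [div_mul_eq_mul_div]
        refine div_le_div_of_nonneg_right ?_ hfpos.le
        have h1 : (Real.exp m)⁻¹ = ((Real.exp 1)⁻¹) ^ m := by
          rw [inv_pow, ← Real.exp_nat_mul, mul_one]
        rw [h1, ← mul_pow]
        refine pow_le_pow_left₀ (Nat.cast_nonneg _) ?_ m
        have h2 : 2 * Real.exp 1 / β * m * (Real.exp 1)⁻¹ = 2 * m / β := by field_simp
        rw [h2, le_div_iff₀ hβ]
        push_cast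
        linarith
    _ = (2 * Real.exp 1 / β) ^ m * ((m : ℝ) ^ m / m.factorial) * (Real.exp m)⁻¹ := by
        rw [mul_pow]; ring
    _ ≤ (2 * Real.exp 1 / β) ^ m * Real.exp m * (Real.exp m)⁻¹ := by
        gcongr
    _ = (2 * Real.exp 1 / β) ^ m := by field_simp
    _ = Real.exp (m * Real.log (2 * Real.exp 1 / β)) := by
        rw [Real.exp_nat_mul, Real.exp_log (by linarith)]
    _ ≤ _ := Real.exp_le_exp.2 (mul_le_mul_of_nonneg_right hm2 (Real.log_nonneg hbase))

/-- A scale at which at least half of the indices obey the bound `θ i`. -/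
theorem exists_scale {ι : Type*} (N : Finset ι) (a : ℕ → ι → ℝ) (ha : ∀ i, ∀ v ∈ N, 0 ≤ a i v)
    (θ : ℕ → ℝ) (hθ : ∀ i, 0 ≤ θ i) {I : ℕ} {R : ℝ} (hR : 0 < R)
    (hsum : ∀ v ∈ N, ∑ i ∈ Finset.range I, a i v ≤ R)
    (hI : 2 * R ≤ ∑ i ∈ Finset.range I, θ i) :
    ∃ i < I, (N.card : ℝ) / 2 ≤ (N.filter fun v => a i v ≤ θ i).card := by
  by_contra! hcon
  have hbad : ∀ i ∈ Finset.range I, N.card / 2 < ((N.filter fun v => θ i < a i v).card : ℝ) := by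
    intro i hi
    have h1 := hcon i (Finset.mem_range.1 hi)
    have h2 : ((N.filter fun v => a i v ≤ θ i).card : ℝ) + (N.filter fun v => θ i < a i v).card =
        N.card := by
      have := Finset.card_filter_add_card_filter_not (s := N) (fun v => a i v ≤ θ i)
      simp only [not_le] at this
      exact_mod_cast this
    linarith
  have hcheb : ∀ i, ((N.filter fun v => θ i < a i v).card : ℝ) * θ i ≤ ∑ v ∈ N, a i v :=
    fun i => card_filter_lt_mul_le N (a i) (ha i) le_rfl
  -- A positive threshold is needed for strictness: the double sum must exceed (|N|/2) · 2R, against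
  -- the upper bound |N| R.
  obtain ⟨k, hk, hθk⟩ : ∃ k ∈ Finset.range I, 0 < θ k := by
    by_contra! h
    have := Finset.sum_nonpos h
    linarith
  have hstrict : ∑ i ∈ Finset.range I, ((N.card : ℝ) / 2) * θ i <
      ∑ i ∈ Finset.range I, ∑ v ∈ N, a i v :=
    Finset.sum_lt_sum
      (fun i hi => (mul_le_mul_of_nonneg_right (hbad i hi).le (hθ i)).trans (hcheb i))
      ⟨k, hk, (mul_lt_mul_of_pos_right (hbad k hk) hθk).trans_le (hcheb k)⟩
  have hle : ∑ i ∈ Finset.range I, ∑ v ∈ N, a i v ≤ N.card * R := by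
    rw [Finset.sum_comm]
    calc _ ≤ ∑ v ∈ N, R := Finset.sum_le_sum hsum
      _ = N.card * R := by rw [Finset.sum_const, nsmul_eq_mul]
  rw [← Finset.mul_sum] at hstrict
  nlinarith [mul_le_mul_of_nonneg_left hI (Nat.cast_nonneg (α := ℝ) N.card)]

theorem sum_windows_le {f : ℕ → ℝ} (hf : ∀ k, 0 ≤ f k) {b : ℕ} (hb : 1 ≤ b) (I : ℕ) :
    ∑ i ∈ Finset.range I, ∑ k ∈ Finset.Ioc (2 * b ^ i) (2 * b ^ (i + 1)), f k ≤
      ∑ k ∈ Finset.range (2 * b ^ I + 1), f k := by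
  have h : ∑ i ∈ Finset.range I, ∑ k ∈ Finset.Ioc (2 * b ^ i) (2 * b ^ (i + 1)), f k =
      ∑ k ∈ Finset.Ioc (2 * b ^ 0) (2 * b ^ I), f k := by
    induction I with
    | zero => simp
    | succ I ih =>
      rw [Finset.sum_range_succ, ih, Finset.sum_Ioc_consecutive]
      · exact Nat.mul_le_mul_left 2 (Nat.pow_le_pow_right hb (Nat.zero_le _))
      · exact Nat.mul_le_mul_left 2 (Nat.pow_le_pow_right hb (Nat.le_succ _))
  rw [h]
  refine Finset.sum_le_sum_of_subset_of_nonneg (fun k hk => ?_) fun k _ _ => hf k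
  rw [Finset.mem_Ioc] at hk
  exact Finset.mem_range.2 (by omega)

/-- This is c log(1/c) → 0; the choice c = z² makes it explicit through log(1/z) ≤ 1/z. -/
theorem exists_small_mul_log {γ b : ℝ} (hγ : 0 < γ) (hb : 1 ≤ b) :
    ∃ c : ℝ, 0 < c ∧ c ≤ 1 ∧
      4 * c * (Real.log (2 * Real.exp 1 / c) + 1 + Real.log b) ≤ γ := by
  set k := Real.log (2 * Real.exp 1) + 1 + Real.log b with hk
  have he : 1 ≤ Real.exp 1 := Real.one_le_exp (by norm_num)
  have hk0 : 0 ≤ k := by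
    have h1 := Real.log_nonneg hb
    have h2 := Real.log_nonneg (by linarith : 1 ≤ 2 * Real.exp 1)
    linarith
  set z := min 1 (γ / (4 * (k + 2))) with hz
  have hz0 : 0 < z := lt_min one_pos (by positivity)
  have hz1 : z ≤ 1 := min_le_left _ _
  have hz2 : z * (4 * (k + 2)) ≤ γ := by
    rw [← le_div_iff₀ (by positivity)]
    exact min_le_right _ _
  refine ⟨z ^ 2, by positivity, by nlinarith, ?_⟩
  have hlog : Real.log (2 * Real.exp 1 / z ^ 2) ≤ Real.log (2 * Real.exp 1) + 2 / z := by
    rw [Real.log_div (by positivity) (by positivity), Real.log_pow]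
    have h1 := Real.log_le_sub_one_of_pos (inv_pos.2 hz0)
    rw [Real.log_inv] at h1
    have h2 : 2 / z = 2 * z⁻¹ := by ring
    push_cast
    linarith
  calc 4 * z ^ 2 * (Real.log (2 * Real.exp 1 / z ^ 2) + 1 + Real.log b)
      ≤ 4 * z ^ 2 * (k + 2 / z) := by
        refine mul_le_mul_of_nonneg_left ?_ (by positivity)
        linarith
    _ = 4 * z * (z * k + 2) := by field_simp
    _ ≤ 4 * z * (k + 2) := by
        refine mul_le_mul_of_nonneg_left ?_ (by positivity)
        nlinarith
    _ ≤ γ := by linarith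

/-! ### Covering at a fixed transient scale. -/

section Scale

open Classical

variable {V : Type*} [Fintype V] [DecidableEq V] {p : Matrix V V ℝ}

/-- The probability of covering a set of vertices that are transient at the scale `L`. -/
theorem pathExp_covers_le_of_scale (hp : p ∈ Matrix.rowStochastic ℝ V) {π : V → ℝ}
    (hrev : IsReversible p π) (hπ : ∀ x, 0 ≤ π x) {W G : Finset V} {K : ℝ}
    (hW : ∀ v ∈ W, 0 < π v) (hWne : W.Nonempty) (hK : ∀ v ∈ W, ∀ v' ∈ W, π v ≤ K * π v')
    (hGW : G ⊆ W) {T L l : ℕ} (hl : 0 < l) (hlL : l ≤ L) (hTL : 3 * L ≤ T) {x : V}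
    {D θ δ β R S' a Y lam : ℝ} (hD : (T : ℝ) ≤ D * Fintype.card V) (hδ0 : 0 < δ)
    (hδ : δ ≤ 1 / 2) (hθ0 : 0 ≤ θ)
    (hθ : ∀ v ∈ G, ∑ k ∈ Finset.Ioc l (2 * L), (p ^ k) v v ≤ θ)
    (hβ : 0 < β) (hβ2 : β ≤ 1 / 2) (hβn : 1 ≤ β * Fintype.card V) (hS' : 0 < S')
    (hA : 0 < pathExp p T x (fun ω => if Covers W T ω then 1 else 0))
    (hR : Real.log (4 * K * Fintype.card V + 4) -
      Real.log (pathExp p T x (fun ω => if Covers W T ω then 1 else 0)) ≤ R) (hR0 : 0 ≤ R)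
    (hY : 2 * (T * l / L + 11 * L * R + 8 * (θ / δ) * T) ≤ Y)
    (ha : a + Real.exp (2 * (S' + 1)) *
      (3 * L + 2 * Y + 4 * (D ^ 2 * δ * Fintype.card V / (L * β))) ≤
      G.card - D * Fintype.card V / S') (hlam : 0 ≤ lam)
    (hlam1 : lam * (3 * Real.exp (2 * (S' + 1)) * L) ≤ 1) :
    pathExp p T x (fun ω => if Covers W T ω then 1 else 0) ≤
      2 * Real.exp (2 * β * Fintype.card V * Real.log (2 * Real.exp 1 / β) +
        (-lam * a + D * Fintype.card V / L *
          (lam * (3 * Real.exp (2 * (S' + 1)) * L)) ^ 2)) := by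
  set n : ℝ := ((Fintype.card V : ℕ) : ℝ) with hn
  set w : (ℕ → V) → ℝ := fun ω => if Covers W T ω then 1 else 0 with hw
  set C := Real.exp (2 * (S' + 1)) with hC
  have hCpos : 0 < C := Real.exp_pos _
  have hL : 0 < L := by omega
  have hL' : (0 : ℝ) < L := by exact_mod_cast hL
  have hn0 : 0 ≤ n := Nat.cast_nonneg _
  have hnpos : 0 < n := by
    rcases hn0.eq_or_lt with h | h
    · rw [← h] at hβn; linarith
    · exact h
  -- J + 1 blocks are used. The two remaining full blocks leave room for the offset and for the N +
  -- 2L ≤ T of the near mass bound; fewer than 3L times remain uncovered by blocks.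
  obtain ⟨J, hJ⟩ : ∃ J, T / L = J + 3 := by
    have : 3 ≤ T / L := (Nat.le_div_iff_mul_le hL).2 hTL
    exact ⟨T / L - 3, by omega⟩
  have hdm := Nat.div_add_mod T L
  have hmod := Nat.mod_lt T hL
  rw [hJ] at hdm
  have hexp : L * (J + 3) = (J + 1) * L + 2 * L := by ring
  have hw0 : ∀ ω, 0 ≤ w ω := fun ω => by simp only [hw]; split_ifs <;> norm_num
  have hw1 : ∀ ω, w ω ≤ 1 := fun ω => by simp only [hw]; split_ifs <;> norm_num
  obtain ⟨o, ho, hoff⟩ := exists_offset_nearMass_le hp hrev hπ (by omega) hw0 hw1 hA hW hWne hK hGW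
    hl hlL hδ0 hθ0 hθ hR hR0 (J := J + 1) (by omega)
  have hJL : ((J + 1 : ℕ) : ℝ) * L ≤ D * n := by
    refine le_trans ?_ hD
    exact_mod_cast (by omega : (J + 1) * L ≤ T)
  have hD0 : 0 ≤ D := by
    by_contra h
    push Not at h
    have h1 : (0 : ℝ) ≤ T := Nat.cast_nonneg T
    nlinarith
  -- Since β n ≥ 1, rounding up at most doubles the sample size.
  set m := ⌈β * n⌉₊ with hm
  have hm1 : β * n ≤ m := Nat.le_ceil _
  have hm0 : 0 < m := by
    have : (0 : ℝ) < m := by linarith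
    exact_mod_cast this
  have hE : ((J + 1 : ℕ) : ℝ) ^ 2 * δ * L / m ≤ D ^ 2 * δ * n / (L * β) := by
    have hmpos : (0 : ℝ) < m := by exact_mod_cast hm0
    have hJ1 : ((J + 1 : ℕ) : ℝ) ≤ D * n / L := by rwa [le_div_iff₀ hL']
    calc ((J + 1 : ℕ) : ℝ) ^ 2 * δ * L / m ≤ (D * n / L) ^ 2 * δ * L / (β * n) := by
          gcongr
      _ = _ := by field_simp
  have hmain := pathExp_covers_nearMass_le hp (G := G) (T := T) (L := L) (o := o) (J := J + 1)
    (m := m) (by omega) (by omega) (by omega) hm0 (Y := Y) (a := a) hδ0.le hδ hS' (by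
      have h1 : (((J + 1 : ℕ) : ℝ) * L) / S' ≤ D * n / S' := div_le_div_of_nonneg_right hJL hS'.le
      have h2 := mul_le_mul_of_nonneg_left hE hCpos.le
      have h3 : a + C * (3 * L + 2 * Y + 4 * (((J + 1 : ℕ) : ℝ) ^ 2 * δ * L / m)) ≤
          a + C * (3 * L + 2 * Y + 4 * (D ^ 2 * δ * n / (L * β))) := by
        linarith
      linarith) hlam hlam1 x
  have hhalf : pathExp p T x w / 2 ≤ pathExp p T x (fun ω => if Covers G T ω ∧
      ∑ j ∈ Finset.range (J + 1), nearMass p L δ G (ω (o + j * L)) ≤ Y then 1 else 0) := by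
    refine hoff.trans (pathExp_mono hp _ _ fun ω _ => ?_)
    by_cases h1 : Covers W T ω
    · have h2 : Covers G T ω := fun v hv => h1 v (hGW hv)
      simp only [hw, if_pos h1, one_mul, h2, true_and]
      split_ifs with h3 h4
      · exact le_rfl
      · exact absurd (h3.trans hY) h4
      · norm_num
      · exact le_rfl
    · simp only [hw, if_neg h1, zero_mul]
      split_ifs <;> norm_num
  have hm2 : (m : ℝ) ≤ 2 * β * n := by
    have := (Nat.ceil_lt_add_one (by linarith : 0 ≤ β * n)).le
    rw [← hm] at this
    linarith
  have hcard := card_sym_le_exp (V := V) hβ hβ2 (Nat.cast_pos.2 hm0) hm1 hm2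
  have hexp2 : Real.exp (-lam * a + ((J + 1 : ℕ) : ℝ) * (lam * (3 * C * L)) ^ 2) ≤
      Real.exp (-lam * a + D * n / L * (lam * (3 * C * L)) ^ 2) := by
    refine Real.exp_le_exp.2 (add_le_add_right (mul_le_mul_of_nonneg_right ?_ (sq_nonneg _)) _)
    rwa [le_div_iff₀ hL']
  have hfin := mul_le_mul hcard hexp2 (Real.exp_pos _).le (Real.exp_pos _).le
  rw [← Real.exp_add] at hfin
  have := (hhalf.trans hmain).trans hfin
  linarith

end Scale

/-- With β = c/((i+1)b^(i+1)), log(1/β) grows linearly in i; the factor i + 1 in β absorbs this, so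
the entropy per vertex is O(1/b^(i+1)) uniformly in i. -/
theorem two_mul_mul_log_le {γ c : ℝ} {b : ℕ} (hc : 0 < c) (hc1 : c ≤ 1) (hb : 1 ≤ b)
    (h : 4 * c * (Real.log (2 * Real.exp 1 / c) + 1 + Real.log b) ≤ γ) (i : ℕ) :
    2 * (c / ((i + 1) * (b ^ (i + 1) : ℕ))) *
      Real.log (2 * Real.exp 1 / (c / ((i + 1) * (b ^ (i + 1) : ℕ)))) ≤
      γ / (2 * (b ^ (i + 1) : ℕ)) := by
  have hb' : (1 : ℝ) ≤ b := by exact_mod_cast hb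
  have hi : (0 : ℝ) < i + 1 := by positivity
  have hbpos : (0 : ℝ) < (b ^ (i + 1) : ℕ) := by exact_mod_cast Nat.pos_of_ne_zero (by positivity)
  have he : 1 ≤ Real.exp 1 := Real.one_le_exp (by norm_num)
  have h1 : Real.log (2 * Real.exp 1 / (c / ((i + 1) * (b ^ (i + 1) : ℕ)))) =
      Real.log (2 * Real.exp 1 / c) + Real.log (i + 1) + (i + 1) * Real.log b := by
    rw [show 2 * Real.exp 1 / (c / ((i + 1) * ((b ^ (i + 1) : ℕ) : ℝ))) =
      2 * Real.exp 1 / c * ((i : ℝ) + 1) * ((b ^ (i + 1) : ℕ) : ℝ) by field_simp]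
    rw [Real.log_mul (by positivity) hbpos.ne', Real.log_mul (by positivity) hi.ne']
    push_cast
    rw [Real.log_pow]
    push_cast
    ring
  have h2 : Real.log ((i : ℝ) + 1) ≤ i + 1 := (Real.log_le_sub_one_of_pos hi).trans (by linarith)
  have h3 : 0 ≤ Real.log (2 * Real.exp 1 / c) := Real.log_nonneg (by
    rw [le_div_iff₀ hc]; linarith)
  have h4 : Real.log (2 * Real.exp 1 / c) ≤ (i + 1) * Real.log (2 * Real.exp 1 / c) :=
    le_mul_of_one_le_left h3 (by linarith [Nat.cast_nonneg (α := ℝ) i])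
  rw [h1, le_div_iff₀ (by positivity)]
  calc 2 * (c / ((i + 1) * ((b ^ (i + 1) : ℕ) : ℝ))) *
        (Real.log (2 * Real.exp 1 / c) + Real.log (i + 1) + (i + 1) * Real.log b) *
        (2 * ((b ^ (i + 1) : ℕ) : ℝ))
      = 4 * c / (i + 1) *
        (Real.log (2 * Real.exp 1 / c) + Real.log (i + 1) + (i + 1) * Real.log b) := by
        field_simp; ring
    _ ≤ 4 * c / (i + 1) * ((i + 1) * (Real.log (2 * Real.exp 1 / c) + 1 + Real.log b)) := by
        refine mul_le_mul_of_nonneg_left ?_ (by positivity)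
        linarith
    _ = 4 * c * (Real.log (2 * Real.exp 1 / c) + 1 + Real.log b) := by field_simp
    _ ≤ γ := h

theorem eventually_mul_log_le {A K y : ℝ} (hA : 0 < A) (hK : 0 < K) (hy : 0 < y) :
    ∀ᶠ n : ℕ in Filter.atTop, A * Real.log (4 * K * n + 4) ≤ y * n := by
  have ht : Filter.Tendsto (fun n : ℕ => 4 * K * (n : ℝ) + 4) Filter.atTop Filter.atTop :=
    Filter.tendsto_atTop_add_const_right _ _
      (tendsto_natCast_atTop_atTop.const_mul_atTop (by positivity))
  have h1 := ht.eventually (Real.isLittleO_log_id_atTop.bound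
    (c := y / (A * (4 * K + 4))) (by positivity))
  filter_upwards [h1, Filter.eventually_ge_atTop 1] with n hn hn1
  have hn1' : (1 : ℝ) ≤ n := by exact_mod_cast hn1
  have hpos : 0 < 4 * K * (n : ℝ) + 4 := by positivity
  simp only [id, Real.norm_eq_abs, abs_of_pos hpos] at hn
  have h2 : 4 * K * (n : ℝ) + 4 ≤ (4 * K + 4) * n := by nlinarith
  calc A * Real.log (4 * K * n + 4) ≤ A * (y / (A * (4 * K + 4)) * (4 * K * n + 4)) :=
        mul_le_mul_of_nonneg_left ((le_abs_self _).trans hn) hA.le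
    _ ≤ A * (y / (A * (4 * K + 4)) * ((4 * K + 4) * n)) := by gcongr
    _ = y * n := by field_simp

/-! ### Choice of constants and the two cases. -/

section Main

open Classical

/-- If the bound failed, escapes at rate α/(32D) and the entropy cost would each account for at most
αn/32, whereas covering needs more than 3αn/16 after the factor log 2 > 1/2. -/
theorem pathExp_covers_lt_of_noReturn {V : Type*} [Fintype V] [DecidableEq V] {p : Matrix V V ℝ}
    (hp : p ∈ Matrix.rowStochastic ℝ V) {α D ε : ℝ} {T m : ℕ} (hα : 0 < α) (hD : 0 < D)
    {W G : Finset V} (hGW : G ⊆ W) (hT : (T : ℝ) ≤ D * Fintype.card V) (hmT : m ≤ T) (hm : 0 < m)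
    (hG : α * Fintype.card V / 2 ≤ G.card)
    (hR : ∀ v ∈ G, 32 * D / α < ∑ k ∈ Finset.range (m + 1), (p ^ k) v v)
    (hε : ε * m ≤ α / 32) (hn : 16 * m < α * Fintype.card V) (x : V) :
    pathExp p T x (fun ω => if Covers W T ω then 1 else 0) ≤
      Real.exp (-(ε * Fintype.card V)) := by
  set n : ℝ := ((Fintype.card V : ℕ) : ℝ) with hndef
  have hn0 : 0 ≤ n := Nat.cast_nonneg _
  have hm' : (0 : ℝ) < m := by exact_mod_cast hm
  set w : (ℕ → V) → ℝ := fun ω => if Covers W T ω then 1 else 0 with hw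
  by_contra! hlt
  have hA : 0 < pathExp p T x w := (Real.exp_pos _).trans hlt
  have hlog : -(ε * n) ≤ Real.log (pathExp p T x w) := (Real.le_log_iff_exp_le hA).2 hlt.le
  obtain ⟨M, hM⟩ : ∃ M, T / m = M + 1 := by
    have : 1 ≤ T / m := (Nat.one_le_div_iff hm).2 hmT
    exact ⟨T / m - 1, by omega⟩
  have hdm := Nat.div_add_mod T m
  have hmod := Nat.mod_lt T hm
  rw [hM] at hdm
  have e1 : (M + 1) * m = m * (M + 1) := Nat.mul_comm _ _
  have e2 : (M + 2) * m = m * (M + 1) + m := by ring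
  have hRpos : 0 < 32 * D / α := by positivity
  have hmain := card_le_of_noReturn_le hp (G := G) (ρ := α / (32 * D)) (w := w) (m := m) (M := M)
    (T := T) (x := x) (by omega) (by omega) (by
      intro v hv
      have h1 := sum_pow_mul_noReturn_le_one hp m v
      have h2 := hR v hv
      have h3 : 0 ≤ pathExp p m v (fun ω => if NoReturn m ω then 1 else 0) :=
        pathExp_nonneg hp _ _ fun ω _ => by split_ifs <;> norm_num
      have h4 := (mul_le_mul_of_nonneg_right h2.le h3).trans h1
      rw [show α / (32 * D) = 1 / (32 * D / α) by field_simp, le_div_iff₀ hRpos]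
      linarith) (by positivity)
    (fun ω => by simp only [hw]; split_ifs <;> norm_num)
    (fun ω => by simp only [hw]; split_ifs <;> norm_num) hA (by
      intro ω hω v hv
      simp only [hw, ne_eq, ite_eq_right_iff, one_ne_zero, imp_false, not_not] at hω
      exact hω v (hGW hv))
  have hMm : (M : ℝ) * m ≤ D * n := by
    refine le_trans ?_ hT
    have : M * m ≤ T := by
      have : (M + 1) * m = M * m + m := by ring
      omega
    exact_mod_cast this
  have h1 : (m : ℝ) * (M * (α / (32 * D)) - Real.log (pathExp p T x w)) ≤
      α * n / 32 + α * n / 32 := by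
    have h2 : (m : ℝ) * M * (α / (32 * D)) ≤ D * n * (α / (32 * D)) :=
      mul_le_mul_of_nonneg_right (by linarith) (by positivity)
    have h3 : D * n * (α / (32 * D)) = α * n / 32 := by field_simp
    have h4 : (m : ℝ) * (-Real.log (pathExp p T x w)) ≤ m * (ε * n) :=
      mul_le_mul_of_nonneg_left (by linarith) hm'.le
    have h5 : (m : ℝ) * (ε * n) ≤ α / 32 * n := by
      rw [show (m : ℝ) * (ε * n) = ε * m * n by ring]
      exact mul_le_mul_of_nonneg_right hε hn0
    nlinarith
  have h6 : (α * n / 2 - 2 * m) * (1 / 2) ≤ ((G.card : ℝ) - 2 * m) * Real.log 2 := by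
    have := Real.log_two_gt_d9
    refine mul_le_mul (by linarith) (by linarith) (by norm_num) (by linarith)
  linarith

/-- Four contributions of at most yn/4: the early lags, the logarithm from the oscillation of the
test function, the entropy εn, and the returns. -/
theorem near_budget_le {T L n D y η ε m b q t : ℝ} (hT : T ≤ D * n) (hn : 0 ≤ n) (hD : 0 < D)
    (hb : 0 < b) (hη : η = y / (64 * D)) (hby : 16 * D ≤ b * y) (hy : 0 < y) (hLm : L ≤ m)
    (hε0 : 0 ≤ ε) (hε : ε * m ≤ y / 88) (hlog0 : 0 ≤ q) (hlog : 22 * m * q ≤ y / 4 * n)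
    (ht : t = 2 * T / b) :
    2 * (t + 11 * L * (q + ε * n) + 8 * η * T) ≤ y * n := by
  have h1 : t ≤ y * n / 8 := by
    rw [ht, div_le_iff₀ hb]
    have := mul_le_mul_of_nonneg_right hby hn
    linarith
  have h2 : 8 * η * T ≤ y * n / 8 := by
    calc 8 * η * T ≤ 8 * η * (D * n) :=
          mul_le_mul_of_nonneg_left hT (by rw [hη]; positivity)
      _ = y * n / 8 := by rw [hη]; field_simp; norm_num
  have h3 : 22 * L * q ≤ y / 4 * n := (mul_le_mul_of_nonneg_right (by linarith) hlog0).trans hlog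
  have h4 : 22 * L * (ε * n) ≤ y / 4 * n := by
    have h5 : ε * L ≤ y / 88 := (mul_le_mul_of_nonneg_left hLm hε0).trans hε
    have h6 := mul_le_mul_of_nonneg_right h5 hn
    linarith
  linarith

/-- The choices of δ and β make k and L cancel in the sampling error. At most αn/8 vertices are lost
to large sampled chance, and three errors of αn/48 leave a drop of αn/16. -/
theorem drop_budget_le {α n C L m y D δ β Q S' g k c : ℝ} (hα : 0 < α) (hC : 0 < C) (hD : 0 < D)
    (hL : 0 < L) (hk : 0 < k) (hc : 0 < c) (hLm : L ≤ m) (hS' : S' = 8 * D / α)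
    (hQ : Q = 192 * C * D / α) (hy : y = α / (96 * C)) (hδ : δ = c / (Q * D * k))
    (hβ : β = c / (k * L)) (hn : 144 * C * m ≤ n * α) (hg : α * n / 4 ≤ g) :
    α * n / 16 + C * (3 * L + 2 * (y * n) + 4 * (D ^ 2 * δ * n / (L * β))) ≤ g - D * n / S' := by
  have e1 : D ^ 2 * δ * n / (L * β) = α * n / (192 * C) := by
    rw [hδ, hβ, hQ]; field_simp
  have e2 : D * n / S' = α * n / 8 := by rw [hS']; field_simp
  have e3 : C * (3 * L + 2 * (y * n) + 4 * (α * n / (192 * C))) =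
      3 * C * L + α * n / 48 + α * n / 48 := by rw [hy]; field_simp; ring
  have h1 : 3 * C * L ≤ α * n / 48 := by
    have := mul_le_mul_of_nonneg_left hLm (by positivity : 0 ≤ 3 * C)
    linarith
  rw [e1, e2, e3]
  linarith

/-- The λ used here minimises the Chernoff exponent: the linear term is -2γn/L and the quadratic one
γn/L, which leaves room for an entropy of γn/(2L). -/
theorem exponent_le {α D C L n γ E : ℝ} (hD : 0 < D) (hC : 0 < C) (hL : 0 < L)
    (hγ : γ = α ^ 2 / (9216 * D * C ^ 2)) (hE : E ≤ γ / (2 * L) * n) :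
    E + (-(α / (288 * D * C ^ 2 * L)) * (α * n / 16) +
      D * n / L * (α / (288 * D * C ^ 2 * L) * (3 * C * L)) ^ 2) ≤ -(γ * n / (2 * L)) := by
  have h2 : -(α / (288 * D * C ^ 2 * L)) * (α * n / 16) = -(2 * (γ * n / L)) := by
    rw [hγ]; field_simp; ring
  have h3 : D * n / L * (α / (288 * D * C ^ 2 * L) * (3 * C * L)) ^ 2 = γ * n / L := by
    rw [hγ]; field_simp; ring
  rw [h2, h3]
  have h4 : γ / (2 * L) * n = γ * n / L / 2 := by field_simp
  have h5 : γ * n / (2 * L) = γ * n / L / 2 := by field_simp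
  linarith

theorem two_mul_exp_le {γ n L m ε : ℝ} (hγ : 0 < γ) (hn : 0 < n) (hL : 0 < L) (hLm : L ≤ m)
    (hε : ε ≤ γ / (4 * m)) (hn5 : 4 * m ≤ n * γ) :
    2 * Real.exp (-(γ * n / (2 * L))) ≤ Real.exp (-(ε * n)) := by
  have hm : 0 < m := hL.trans_le hLm
  have h1 : (2 : ℝ) ≤ Real.exp 1 := by linarith [Real.add_one_le_exp (1 : ℝ)]
  have h2 : 1 ≤ γ * n / (4 * m) := by
    rw [le_div_iff₀ (by positivity)]; linarith
  have h3 : γ * n / (2 * m) ≤ γ * n / (2 * L) := by gcongr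
  have h4 : ε * n ≤ γ * n / (4 * m) := by
    have := mul_le_mul_of_nonneg_right hε hn.le
    rwa [div_mul_eq_mul_div] at this
  have h5 : γ * n / (2 * m) = 2 * (γ * n / (4 * m)) := by field_simp; norm_num
  calc 2 * Real.exp (-(γ * n / (2 * L))) ≤ Real.exp 1 * Real.exp (-(γ * n / (2 * L))) :=
        mul_le_mul_of_nonneg_right h1 (Real.exp_pos _).le
    _ = Real.exp (1 + -(γ * n / (2 * L))) := (Real.exp_add _ _).symm
    _ ≤ Real.exp (-(ε * n)) := Real.exp_le_exp.2 (by linarith)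

/-- Argument by contradiction: A > exp(-εn) is what bounds the near mass, and the resulting tail
estimate then gives A ≤ exp(-εn). -/
theorem pathExp_covers_le_of_transient {V : Type*} [Fintype V] [DecidableEq V] {p : Matrix V V ℝ}
    (hp : p ∈ Matrix.rowStochastic ℝ V) {π : V → ℝ} (hrev : IsReversible p π)
    (hπ : ∀ x, 0 ≤ π x) {W G : Finset V} {K : ℝ} (hK1 : 1 ≤ K)
    (hW : ∀ v ∈ W, 0 < π v) (hWne : W.Nonempty) (hK : ∀ v ∈ W, ∀ v' ∈ W, π v ≤ K * π v')
    (hGW : G ⊆ W) {α D S' C γ Q y η c ε : ℝ} {T b i m : ℕ} (hα : 0 < α) (hα1 : α ≤ 1)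
    (hD : 1 ≤ D) (hS' : S' = 8 * D / α) (hC : C = Real.exp (2 * (S' + 1)))
    (hγ : γ = α ^ 2 / (9216 * D * C ^ 2)) (hQ : Q = 192 * C * D / α) (hy : y = α / (96 * C))
    (hη : η = y / (64 * D)) (hb2 : 2 ≤ b) (hby : 16 * D ≤ b * y) (hc0 : 0 < c) (hc1 : c ≤ 1)
    (hcγ : 4 * c * (Real.log (2 * Real.exp 1 / c) + 1 + Real.log b) ≤ γ)
    (hLm : b ^ (i + 1) ≤ m) (hε0 : 0 ≤ ε) (hε2 : ε * m ≤ y / 88) (hε3 : ε ≤ γ / (4 * m))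
    (hn2 : 144 * C * m ≤ Fintype.card V * α)
    (hn3 : 22 * m * Real.log (4 * K * Fintype.card V + 4) ≤ y / 4 * Fintype.card V)
    (hn4 : (i + 1) * m ≤ Fintype.card V * c) (hn5 : 4 * m ≤ Fintype.card V * γ)
    (hTD : (T : ℝ) ≤ D * Fintype.card V) (hT4 : 4 * m ≤ T)
    (hGcard : α * Fintype.card V / 4 ≤ G.card)
    (hθ : ∀ v ∈ G, ∑ k ∈ Finset.Ioc (2 * b ^ i) (2 * b ^ (i + 1)), (p ^ k) v v ≤
      η * c / (Q * D * ((i : ℝ) + 1))) (x : V) :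
    pathExp p T x (fun ω => if Covers W T ω then 1 else 0) ≤
      Real.exp (-(ε * Fintype.card V)) := by
  have hD0 : 0 < D := by linarith
  have hS'0 : 0 < S' := by rw [hS']; positivity
  have hC1 : 1 ≤ C := hC ▸ Real.one_le_exp (by positivity)
  have hC0 : 0 < C := by linarith
  have hγ0 : 0 < γ := by rw [hγ]; positivity
  have hQ0 : 0 < Q := by rw [hQ]; positivity
  have hy0 : 0 < y := by rw [hy]; positivity
  have hη0 : 0 < η := by rw [hη]; positivity
  have hb0 : (0 : ℝ) < b := by exact_mod_cast (by omega : 0 < b)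
  have hDC : 1 ≤ D * C := one_le_mul_of_one_le_of_one_le hD hC1
  have hQD : 2 ≤ Q * D := by
    have h1 : 192 ≤ Q := by
      rw [hQ, le_div_iff₀ hα]
      linarith
    nlinarith only [h1, hD]
  have hi1 : (1 : ℝ) ≤ (i : ℝ) + 1 := by linarith [Nat.cast_nonneg (α := ℝ) i]
  have hb1 : b ^ 1 ≤ b ^ (i + 1) := Nat.pow_le_pow_right (by omega) (by omega)
  rw [pow_one] at hb1
  have hl : 2 * b ^ i ≤ b ^ (i + 1) := by
    rw [pow_succ, mul_comm (b ^ i)]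
    exact Nat.mul_le_mul_right _ hb2
  have hratio : (T : ℝ) * (2 * b ^ i : ℕ) / (b ^ (i + 1) : ℕ) = 2 * T / b := by
    push_cast
    rw [pow_succ]
    field_simp
  have hent := two_mul_mul_log_le hc0 hc1 (by omega : 1 ≤ b) hcγ i
  have hbi0 : 0 < 2 * b ^ i := by positivity
  obtain ⟨L, hL⟩ : ∃ L, L = b ^ (i + 1) := ⟨_, rfl⟩
  rw [← hL] at hLm hθ hb1 hl hratio hent
  have hL' : (0 : ℝ) < L := by exact_mod_cast (by omega : 0 < L)
  have hL2 : (2 : ℝ) ≤ L := by exact_mod_cast hb2.trans hb1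
  have hLm' : (L : ℝ) ≤ m := by exact_mod_cast hLm
  have hi0 : (0 : ℝ) < (i : ℝ) + 1 := by linarith
  have hδ0 : 0 < c / (Q * D * ((i : ℝ) + 1)) := by positivity
  have hδ2 : c / (Q * D * ((i : ℝ) + 1)) ≤ 1 / 2 := by
    rw [div_le_iff₀ (by positivity)]
    have : 2 ≤ Q * D * ((i : ℝ) + 1) := hQD.trans (le_mul_of_one_le_right (by positivity) hi1)
    linarith
  -- The return bound is δ times η, so the flow out through near pairs is the constant η at every
  -- scale.
  have hθδ : η * c / (Q * D * ((i : ℝ) + 1)) / (c / (Q * D * ((i : ℝ) + 1))) = η := by field_simp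
  have hβ0 : 0 < c / (((i : ℝ) + 1) * L) := by positivity
  have hβ2 : c / (((i : ℝ) + 1) * L) ≤ 1 / 2 := by
    rw [div_le_iff₀ (by positivity)]
    have : 2 ≤ ((i : ℝ) + 1) * L := hL2.trans (le_mul_of_one_le_left hL'.le hi1)
    linarith
  have hβn : 1 ≤ c / (((i : ℝ) + 1) * L) * Fintype.card V := by
    rw [div_mul_eq_mul_div, le_div_iff₀ (by positivity), one_mul]
    have : ((i : ℝ) + 1) * L ≤ (i + 1) * m := mul_le_mul_of_nonneg_left hLm' hi0.le
    linarith
  have hn0 : (0 : ℝ) ≤ Fintype.card V := Nat.cast_nonneg _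
  have hnpos : (0 : ℝ) < Fintype.card V := by
    refine lt_of_le_of_ne hn0 fun h => ?_
    rw [← h] at hβn
    linarith
  by_contra! hlt
  have hA : 0 < pathExp p T x (fun ω => if Covers W T ω then 1 else 0) :=
    (Real.exp_pos _).trans hlt
  have hlog := (Real.le_log_iff_exp_le hA).2 hlt.le
  have hKn : 1 ≤ 4 * K * (Fintype.card V : ℝ) + 4 := by
    have : 0 ≤ 4 * K * (Fintype.card V : ℝ) := by positivity
    linarith
  have hlog0 := Real.log_nonneg hKn
  have hεn : 0 ≤ ε * (Fintype.card V : ℝ) := mul_nonneg hε0 hn0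
  have hlam1 : α / (288 * D * C ^ 2 * L) * (3 * C * L) ≤ 1 := by
    have e : α / (288 * D * C ^ 2 * L) * (3 * C * L) = α / (96 * (D * C)) := by
      field_simp; norm_num
    rw [e, div_le_one (by positivity)]
    linarith
  have hY := near_budget_le hTD hn0 hD0 hb0 hη hby hy0 hLm' hε0 hε2 hlog0 hn3 hratio
  rw [← hθδ] at hY
  have ha := drop_budget_le hα hC0 hD0 hL' hi0 hc0 hLm' hS' hQ hy rfl rfl hn2 hGcard
  have hfin := pathExp_covers_le_of_scale hp hrev hπ hW hWne hK hGW (T := T) (L := L)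
    (l := 2 * b ^ i) hbi0 hl (by omega) (x := x) hTD hδ0 hδ2 (by positivity) hθ hβ0 hβ2 hβn hS'0 hA
    (R := Real.log (4 * K * Fintype.card V + 4) + ε * Fintype.card V) (by linarith) (by linarith)
    hY (hC ▸ ha) (lam := α / (288 * D * C ^ 2 * L)) (by positivity) (by rwa [← hC])
  rw [← hC] at hfin
  have hE : 2 * (c / (((i : ℝ) + 1) * L)) * Fintype.card V *
      Real.log (2 * Real.exp 1 / (c / (((i : ℝ) + 1) * L))) ≤
      γ / (2 * L) * Fintype.card V := by
    refine le_trans (le_of_eq ?_) (mul_le_mul_of_nonneg_right hent hn0)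
    ring
  have hexponent := exponent_le hD0 hC0 hL' hγ hE
  have hlast := two_mul_exp_le hγ0 hnpos hL' hLm' hε3 hn5
  have := hfin.trans (mul_le_mul_of_nonneg_left (Real.exp_le_exp.2 hexponent) zero_le_two)
  linarith

theorem exists_pathExp_covers_le (α K D : ℝ) (hα : 0 < α) (hα1 : α ≤ 1) (hK1 : 1 ≤ K)
    (hD : 1 ≤ D) :
    ∃ ε : ℝ, 0 < ε ∧ ∃ n₀ : ℕ, ∀ (V : Type*) [Fintype V] [DecidableEq V] (p : Matrix V V ℝ)
      (π : V → ℝ) (W : Finset V), n₀ ≤ Fintype.card V → p ∈ Matrix.rowStochastic ℝ V →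
      (∀ x, 0 ≤ π x) → IsReversible p π → α * (Fintype.card V : ℝ) ≤ (W.card : ℝ) →
      (∀ w ∈ W, 0 < π w) → (∀ v ∈ W, ∀ w ∈ W, π v ≤ K * π w) → ∀ x,
      pathExp p ⌊D * Fintype.card V⌋₊ x
        (fun ω => if Covers W ⌊D * Fintype.card V⌋₊ ω then 1 else 0) ≤
        Real.exp (-(ε * Fintype.card V)) := by
  have hD0 : 0 < D := by linarith
  obtain ⟨S', hS'⟩ : ∃ S', S' = 8 * D / α := ⟨_, rfl⟩
  obtain ⟨C, hC⟩ : ∃ C, C = Real.exp (2 * (S' + 1)) := ⟨_, rfl⟩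
  have hC0 : 0 < C := hC ▸ Real.exp_pos _
  obtain ⟨γ, hγ⟩ : ∃ γ, γ = α ^ 2 / (9216 * D * C ^ 2) := ⟨_, rfl⟩
  have hγ0 : 0 < γ := by rw [hγ]; positivity
  obtain ⟨Q, hQ⟩ : ∃ Q, Q = 192 * C * D / α := ⟨_, rfl⟩
  have hQ0 : 0 < Q := by rw [hQ]; positivity
  obtain ⟨y, hy⟩ : ∃ y, y = α / (96 * C) := ⟨_, rfl⟩
  have hy0 : 0 < y := by rw [hy]; positivity
  obtain ⟨η, hη⟩ : ∃ η, η = y / (64 * D) := ⟨_, rfl⟩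
  have hη0 : 0 < η := by rw [hη]; positivity
  obtain ⟨b, hb2, hby⟩ : ∃ b : ℕ, 2 ≤ b ∧ 16 * D ≤ b * y := by
    obtain ⟨b₀, hb₀⟩ := exists_nat_ge (16 * D / y)
    refine ⟨max 2 b₀, le_max_left _ _, ?_⟩
    rw [← div_le_iff₀ hy0]
    exact hb₀.trans (by exact_mod_cast le_max_right _ _)
  obtain ⟨c, hc0, hc1, hcγ⟩ := exists_small_mul_log hγ0
    (by exact_mod_cast (by omega : 1 ≤ b) : (1 : ℝ) ≤ b)
  have hR0 : 0 < 32 * D / α := by positivity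
  -- Divergence of the harmonic series: with enough scales the thresholds add up to twice the Green
  -- function bound.
  obtain ⟨I, hI⟩ : ∃ I : ℕ, 2 * (32 * D / α) ≤
      ∑ i ∈ Finset.range I, η * c / (Q * D * ((i : ℝ) + 1)) := by
    have ht := Real.tendsto_sum_range_one_div_nat_succ_atTop.eventually_ge_atTop
      (2 * (32 * D / α) / (η * c / (Q * D)))
    obtain ⟨I, hI⟩ := ht.exists
    refine ⟨I, ?_⟩
    rw [div_le_iff₀ (by positivity), Finset.sum_mul] at hI
    refine hI.trans (le_of_eq (Finset.sum_congr rfl fun i _ => ?_))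
    field_simp
  -- The end of the last window, so that the Green function up to m dominates all windows.
  obtain ⟨m, hm⟩ : ∃ m, m = 2 * b ^ I := ⟨_, rfl⟩
  have hm0 : 0 < m := by rw [hm]; positivity
  have hm' : (0 : ℝ) < m := by exact_mod_cast hm0
  obtain ⟨ε, hε0, hε1, hε2, hε3⟩ : ∃ ε : ℝ, 0 < ε ∧ ε * m ≤ α / 32 ∧ ε * m ≤ y / 88 ∧
      ε ≤ γ / (4 * m) := by
    refine ⟨min (α / 32) (min (y / 88) (γ / 4)) / m, by positivity, ?_, ?_, ?_⟩
    · rw [div_mul_cancel₀ _ hm'.ne']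
      exact min_le_left _ _
    · rw [div_mul_cancel₀ _ hm'.ne']
      exact (min_le_right _ _).trans (min_le_left _ _)
    · rw [← div_div]
      exact div_le_div_of_nonneg_right ((min_le_right _ _).trans (min_le_right _ _)) hm'.le
  have hlin : ∀ a : ℝ, ∀ᶠ n : ℕ in Filter.atTop, a ≤ n := fun a =>
    tendsto_natCast_atTop_atTop.eventually_ge_atTop a
  obtain ⟨n₀, hn₀⟩ := Filter.eventually_atTop.1 ((hlin (17 * m / α)).and
    ((hlin (144 * C * m / α)).and ((eventually_mul_log_le (A := 22 * m) (K := K) (y := y / 4)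
      (by positivity) (by linarith) (by positivity)).and ((hlin (I * m / c)).and
        ((hlin (4 * m / γ)).and (hlin (4 * m)))))))
  refine ⟨ε, hε0, n₀, ?_⟩
  intro V _ _ p π W hcard hp hπ hrev hαW hW hK x
  obtain ⟨hn1, hn2, hn3, hn4, hn5, hn6⟩ := hn₀ _ hcard
  rw [div_le_iff₀ hα] at hn1 hn2
  rw [div_le_iff₀ hc0] at hn4
  rw [div_le_iff₀ hγ0] at hn5
  have hnpos : (0 : ℝ) < Fintype.card V := by linarith
  have hTD : (⌊D * (Fintype.card V : ℝ)⌋₊ : ℝ) ≤ D * Fintype.card V :=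
    Nat.floor_le (by positivity)
  have hT4 : 4 * m ≤ ⌊D * (Fintype.card V : ℝ)⌋₊ := by
    refine Nat.le_floor ?_
    push_cast
    exact hn6.trans (le_mul_of_one_le_left hnpos.le hD)
  -- The dichotomy between many recurrent and many transient vertices of `W`.
  by_cases hrec : α * Fintype.card V / 2 ≤
      ((W.filter fun v => 32 * D / α < ∑ k ∈ Finset.range (m + 1), (p ^ k) v v).card : ℝ)
  · exact pathExp_covers_lt_of_noReturn hp hα hD0 (Finset.filter_subset _ _) hTD (by omega) hm0
      hrec (fun v hv => (Finset.mem_filter.1 hv).2) hε1 (by linarith) x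
  push Not at hrec
  obtain ⟨N, hN⟩ : ∃ N, N = W.filter fun v =>
    ¬ 32 * D / α < ∑ k ∈ Finset.range (m + 1), (p ^ k) v v := ⟨_, rfl⟩
  have hNcard : α * Fintype.card V / 2 ≤ N.card := by
    have h1 := Finset.card_filter_add_card_filter_not (s := W)
      (fun v => 32 * D / α < ∑ k ∈ Finset.range (m + 1), (p ^ k) v v)
    rw [← hN] at h1
    have h2 := congrArg (Nat.cast : ℕ → ℝ) h1
    push_cast at h2
    linarith
  have hnn : ∀ k v, 0 ≤ (p ^ k) v v := fun k v =>
    Matrix.nonneg_of_mem_rowStochastic (pow_mem hp k)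
  obtain ⟨i, hiI, hi⟩ := exists_scale N
    (fun i v => ∑ k ∈ Finset.Ioc (2 * b ^ i) (2 * b ^ (i + 1)), (p ^ k) v v)
    (fun i v _ => Finset.sum_nonneg fun k _ => hnn k v)
    (fun i => η * c / (Q * D * ((i : ℝ) + 1))) (fun i => by positivity) hR0
    (fun v hv => by
      rw [hN] at hv
      refine (sum_windows_le (fun k => hnn k v) (by omega) I).trans ?_
      rw [← hm]
      exact not_lt.1 (Finset.mem_filter.1 hv).2) hI
  have hWne : W.Nonempty := by
    rw [← Finset.card_pos]
    have : (0 : ℝ) < W.card := lt_of_lt_of_le (by positivity) hαW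
    exact_mod_cast this
  have hLm : b ^ (i + 1) ≤ m := by
    have : b ^ (i + 1) ≤ b ^ I := Nat.pow_le_pow_right (by omega) hiI
    omega
  have hn4' : ((i : ℝ) + 1) * m ≤ Fintype.card V * c := by
    have : (i : ℝ) + 1 ≤ I := by exact_mod_cast hiI
    exact (mul_le_mul_of_nonneg_right this hm'.le).trans hn4
  exact pathExp_covers_le_of_transient hp hrev hπ hK1 hW hWne hK
    ((Finset.filter_subset _ _).trans (hN ▸ Finset.filter_subset _ _)) hα hα1 hD hS' hC hγ hQ hy hη
    hb2 hby hc0 hc1 hcγ hLm hε0.le hε2 hε3 hn2 hn3 hn4' hn5 hTD hT4 (le_trans (by linarith) hi)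
    (fun v hv => (Finset.mem_filter.1 hv).2) x

end Main

theorem mainTheorem6 (α K D : ℝ) (hα : 0 < α) :
    ∃ ε : ℝ, 0 < ε ∧ ∃ n₀ : ℕ,
      ∀ (V : Type*) [Fintype V] [DecidableEq V] (p : Matrix V V ℝ) (π : V → ℝ)
        (Ω : Type*) [MeasurableSpace Ω] (P : Measure Ω) [IsProbabilityMeasure P]
        (X : ℕ → Ω → V) (W : Finset V),
        n₀ ≤ Fintype.card V →
        IsMarkovChain P p X →
        IsStationaryDistribution p π →
        IsReversible p π →
        α * (Fintype.card V : ℝ) ≤ (W.card : ℝ) →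
        (∀ w ∈ W, 0 < π w) →
        (∀ v ∈ W, ∀ w ∈ W, π v ≤ K * π w) →
        P.real {ω | visited X (timesUpTo (D * (Fintype.card V : ℝ))) ω = Set.univ} ≤
          Real.exp (-(ε * (Fintype.card V : ℝ))) := by
  classical
  -- The statement is monotone in the constants: smaller α and larger K weaken the hypotheses, and a
  -- larger D gives more time to cover, so α ≤ 1 ≤ K, D may be assumed.
  obtain ⟨ε, hε, n₀, h⟩ := exists_pathExp_covers_le (min α 1) (max K 1) (max D 1)
    (lt_min hα one_pos) (min_le_right _ _) (le_max_right _ _) (le_max_right _ _)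
  refine ⟨ε, hε, n₀, ?_⟩
  intro V _ _ p π Ω _ P _ X W hn hX hstat hrev hαW hW hK
  have hn0 : (0 : ℝ) ≤ Fintype.card V := Nat.cast_nonneg _
  have hbound := h V p π W hn hX.stochastic hstat.1.1 hrev
    ((mul_le_mul_of_nonneg_right (min_le_left _ _) hn0).trans hαW) hW
    (fun v hv w hw => (hK v hv w hw).trans
      (mul_le_mul_of_nonneg_right (le_max_left _ _) (hW w hw).le))
  set T := ⌊max D 1 * (Fintype.card V : ℝ)⌋₊ with hT
  have hdep : DependsOn (fun ω : ℕ → V => ω ∈ {ω : ℕ → V | Covers W T ω}) (Set.Iic T) := by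
    intro ω ω' hω
    refine propext (forall_congr' fun v => forall_congr' fun _ => exists_congr fun t =>
      and_congr_right fun _ => and_congr_right fun ht => ?_)
    rw [hω t (Set.mem_Iic.2 ht)]
  refine le_trans (measureReal_mono ?_ (measure_ne_top P _))
    (hX.measureReal_le {ω | Covers W T ω} T hdep (c := Real.exp (-(ε * Fintype.card V))) ?_)
  · intro ω hω v _
    have hv : v ∈ visited X (timesUpTo (D * (Fintype.card V : ℝ))) ω := by
      have : visited X (timesUpTo (D * (Fintype.card V : ℝ))) ω = Set.univ := hω
      rw [this]
      exact Set.mem_univ v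
    obtain ⟨t, ⟨ht1, ht2⟩, htv⟩ := hv
    refine ⟨t, ht1, Nat.le_floor (ht2.trans ?_), htv⟩
    exact mul_le_mul_of_nonneg_right (le_max_left _ _) hn0
  · exact hbound
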